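/- **Setting.** Let $T>0$, $r\ge 1$, $n\ge 2r+1$. Let $\mathcal Q\subseteq\mathbb R^N$ be open (the coordinate domain of the configuration space, with coordinates $q^i$) and let $K\subset\mathbb R^M$ be the closure of a bounded open set, with smooth boundary. Points of the $n$-jet space $J^n$ over $[0,T]$ are $(t,q^i_{(0)},\dots,q^i_{(n)})$ with $t\in[0,T]$, $q_{(0)}\in\mathcal Q$; $j^n_t(\gamma)=(t,\gamma(t),\dot\gamma(t),\dots,\gamma^{(n)}(t))$, and $\frac{d}{dt}=\frac{\partial}{\partial t}+\sum_{j,\,\delta<n}q^j_{(\delta+1)}\frac{\partial}{\partial q^j_{(\delta)}}$. A function on $J^n$ has order $k$ if it does not depend on $q_{(\beta)}$, $\beta>k$. Let * $L:J^n\times K\to\mathbb R$ be smooth and of order $r$ in the jet variables; for a smooth control curve $u:[0,T]\to K$ put $L^{u}(t,q_{(\beta)})=L(t,q_{(\beta)},u(t))$; * $C:J^n\to\mathbb R$ be smooth, of order at most $r-1$ (so $dC/dt$ has order at most $r$), and zero at all jets at $t=0$; * $\mathcal K$ be a set of pairs $U=(u(\cdot),\sigma)$, with $u:[0,T]\to K$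 a smooth curve and $\sigma$ a $(2r-1)$-jet at $t=0$, such that for each $U\in\mathcal K$ there is a unique smooth $\gamma^{(U)}:[0,T]\to\mathcal Q$ with $j^{2r-1}_{0}(\gamma^{(U)})=\sigma$ that solves the Euler–Lagrange equations of $L^u$, $$\frac{\partial L^{u}}{\partial q^i}+\sum_{\beta=1}^r(-1)^\beta\frac{d^\beta}{dt^\beta}\Big(\frac{\partial L^{u}}{\partial q^i_{(\beta)}}\Big)=0\quad\text{along } j^n_t(\gamma^{(U)}),\qquad 1\le i\le N .$$ For a function $f$ on $J^n$ and $0\le\beta\le r-1$ let $\pi^\beta_i(f)=\sum_{\delta,\varepsilon}(-1)^\varepsilon\frac{d^\varepsilon}{dt^\varepsilon}\big(\frac{\partial f}{\partial q^i_{(\delta)}}\big)$, summed over $1\le\delta\le r$, $0\le\varepsilon\le\delta$, $\delta-\varepsilon-1=\beta$. To $U=(u,\sigma)\in\mathcal K$ and $\gamma=\gamma^{(U)}$ associate, for $1\le i\le N$, $0\le\beta\le r-1$, the functions of $t$ $$\mathbf h^i_\beta=Ae^{t}+Be^{-t},\qquad \mathbf h'^i_\beta,\ \mathbf h''^i_\beta\in\mathrm{span}\big(e^{kt},e^{-kt},\cos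 kt,\sin kt\big),\quad k=\tfrac{\pi}{2T},$$ determined by $$\mathbf h^i_\beta(0)=q^i_{(\beta)}(0),\quad \dot{\mathbf h}^i_\beta(0)=-\pi^\beta_i(L^u)\big|_{j^n_0(\gamma)},$$ $$\mathbf h'^i_\beta(0)=\dot{\mathbf h}'^i_\beta(0)=0,\quad \dot{\mathbf h}'^i_\beta(T)=q^i_{(\beta)}(T),\quad \ddot{\mathbf h}'^i_\beta(T)=\pi^\beta_i\big(L^u+\tfrac{dC}{dt}\big)\big|_{j^n_T(\gamma)},$$ $$\mathbf h''^i_\beta(0)=\dot{\mathbf h}''^i_\beta(0)=0,\quad \dot{\mathbf h}''^i_\beta(T)=\mathbf h^i_\beta(T),\quad \ddot{\mathbf h}''^i_\beta(T)=\dot{\mathbf h}^i_\beta(T).$$ On the jets of curves $(q^i,\mathbf h^i_\beta,\mathbf h'^i_\beta,\mathbf h''^i_\beta,\lambda,\mu)$ put $$\widetilde L=L+\tfrac12\sum_{i,\beta}\Big((\mathbf h^i_{\beta(1)})^2-(\mathbf h'^i_{\beta(2)})^2-(\mathbf h''^i_{\beta(2)})^2\Big)+\sum_{i,\beta}\Big(\tfrac12(\mathbf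 h^i_\beta)^2+\tfrac{\pi^4}{32T^4}(\mathbf h'^i_\beta)^2+\tfrac{\pi^4}{32T^4}(\mathbf h''^i_\beta)^2\Big),\qquad \widehat L=\lambda(\mu_{(1)}+\widetilde L)+\tfrac{dC}{dt},$$ where $i=1,\dots,N$ and $\beta=0,\dots,r-1$, and let $\widehat\gamma^{(U)}=(q^i,\mathbf h^i_\beta,\mathbf h'^i_\beta,\mathbf h''^i_\beta,\lambda\equiv1,\mu)$ with $q=\gamma^{(U)}$ and $\mu(t)=-\int_0^t\widetilde L\,d\tau$ along the curve. With the contact forms $\omega^y_{(\delta)}=dy_{(\delta)}-y_{(\delta+1)}dt$ of the coordinates $y$, the controlled Poincaré–Cartan form along $u$ is $$\alpha^{PC}=\widehat L\,dt+\lambda\sum_i\sum_{\delta=1}^r\sum_{\varepsilon=0}^{\delta-1}(-1)^\varepsilon\frac{d^\varepsilon}{dt^\varepsilon}\Big(\frac{\partial(L^u+\frac{dC}{dt})}{\partial q^i_{(\delta)}}\Big)\omega^{q^i}_{(\delta-\varepsilon-1)}+\lambda\,\omega^{\mu}_{(0)}$$ $$\qquad+\lambda\sum_{i,\beta}\Big(\mathbf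 h^i_{\beta(1)}\omega^{\mathbf h^i_\beta}_{(0)}-\mathbf h'^i_{\beta(2)}\omega^{\mathbf h'^i_\beta}_{(1)}-\mathbf h''^i_{\beta(2)}\omega^{\mathbf h''^i_\beta}_{(1)}+\mathbf h'^i_{\beta(3)}\omega^{\mathbf h'^i_\beta}_{(0)}+\mathbf h''^i_{\beta(3)}\omega^{\mathbf h''^i_\beta}_{(0)}\Big).$$ **Statement.** Let $U(s)=(u(\cdot,s),\sigma(s))\in\mathcal K$, $s\in[0,1]$, be a smooth curve (i.e. $u(t,s)$ is smooth on $[0,T]\times[0,1]$ and $\sigma(s)$ is smooth) for which $F(t,s)=\gamma^{(U(s))}(t)$ is a smooth homotopy on $[0,T]\times[0,1]$. Put $\widehat F^{(n)}(t,s)=\big(j^n_t(\widehat\gamma^{(U(s))}),u(t,s)\big)$, $Y_{\widehat F}=\partial\widehat F^{(n)}/\partial s$, with components $Y'^i_{\beta(0)},Y''^i_{\beta(0)}$ along the coordinates $\mathbf h'^i_\beta,\mathbf h''^i_\beta$, and $Y^a=\partial u^a/\partial s$. Let $\mathscr P_\sigma(w)=-L(\sigma,w)$ for $w\in K$, $\sigma^{(s)}_t=j^n_t(\gamma^{(U(s))})$,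 $C_s=C(j^n_T(\gamma^{(U(s))}))$, let $\mu(t,s)$ be the $\mu$-component of $\widehat\gamma^{(U(s))}(t)$, and $$\mu'(t,s)=\mu(t,s)+\sum_{\beta=0}^{r-1}\sum_{i=1}^N\int_0^s\Big(\mathbf h'^i_{\beta(3)}Y'^i_{\beta(0)}+\mathbf h''^i_{\beta(3)}Y''^i_{\beta(0)}\Big)\Big|_{\widehat F^{(n)}(t,v)}dv .$$ Then: (i) $\displaystyle C_1-C_0=-\int_0^T\!\!\int_0^1\Big(\sum_a Y^a\,\frac{\partial\mathscr P_{\sigma^{(s)}_t}}{\partial u^a}\Big|_{u(t,s)}-\frac{\partial^2\mu'}{\partial t\,\partial s}\Big|_{(t,s)}\Big)\,ds\,dt$; (ii) for every $s_o\in[0,1]$, with $\alpha^{PC}$ taken along $u(\cdot,s_o)$, $$\alpha^{PC}(Y_{\widehat F})\big|_{\widehat F^{(n)}(T,s_o)}=\alpha^{PC}(Y_{\widehat F})\big|_{\widehat F^{(n)}(0,s_o)}+\int_0^T\frac{\partial^2\mu'}{\partial t\,\partial s}\Big|_{s=s_o}dt .$$ -/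

import Mathlib

open Set
open scoped ContDiff Matrix

noncomputable section

namespace GeneralisedMayer

/-! ## Jets of curves, total derivatives, Euler-Lagrange operators

Curves in a configuration space with (global) coordinates indexed by `ι` are maps
`c : ℝ → ι → ℝ`; only their restrictions to the time interval `[0, T]` matter, and derivatives
at the end points of `[0, T]` are one-sided. -/

/-- The points `(t, y_(0), y_(1), …, y_(n))` of the space of `n`-jets of parameterised graphs
`t ↦ (t, y(t))`, in canonical jet coordinates. -/
abbrev Jet (ι : Type) (n : ℕ) : Type := ℝ × (Fin (n + 1) → ι → ℝ)

/-- The `n`-jet at time `t` of the curve `c` over `[0, T]`. -/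
def jet {ι : Type} [Fintype ι] (n : ℕ) (T : ℝ) (c : ℝ → ι → ℝ) (t : ℝ) : Jet ι n :=
  (t, fun β => iteratedDerivWithin β c (Icc 0 T) t)

/-- The jet coordinate `y^ℓ_(β)` (by convention `0` for `β > n`, which is never used). -/
def coord {ι : Type} {n : ℕ} (p : Jet ι n) (β : ℕ) (ℓ : ι) : ℝ :=
  if hβ : β < n + 1 then p.2 ⟨β, hβ⟩ ℓ else 0

section JetCalculus

variable {N n : ℕ} (T : ℝ) (Q : Set (Fin N → ℝ))

/-- The jets over `[0, T]` of curves with values in `Q`. -/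
def jetDomain (N n : ℕ) (T : ℝ) (Q : Set (Fin N → ℝ)) : Set (Jet (Fin N) n) :=
  {p | p.1 ∈ Icc 0 T ∧ p.2 0 ∈ Q}

/-- `f` has actual order (at most) `k`: it does not depend on the jet coordinates `q_(β)` with
`β ≥ k + 1`. -/
def HasOrder (f : Jet (Fin N) n → ℝ) (k : ℕ) : Prop :=
  ∀ p ∈ jetDomain N n T Q, ∀ p' ∈ jetDomain N n T Q, p.1 = p'.1 →
    (∀ β : Fin (n + 1), (β : ℕ) ≤ k → p.2 β = p'.2 β) → f p = f p'

/-- The partial derivative `∂f/∂q^i_(β)`. -/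
def partialQ (f : Jet (Fin N) n → ℝ) (β : ℕ) (i : Fin N) (p : Jet (Fin N) n) : ℝ :=
  fderivWithin ℝ f (jetDomain N n T Q) p
    (0, fun (β' : Fin (n + 1)) (j : Fin N) => if (β' : ℕ) = β ∧ j = i then 1 else 0)

/-- The total derivative `df/dt = ∂f/∂t + ∑_{j, δ < n} q^j_(δ+1) ∂f/∂q^j_(δ)` of a function of
actual order at most `n - 1`, written as the derivative of `f` along the vector
`∂/∂t + ∑_{j, δ < n} q^j_(δ+1) ∂/∂q^j_(δ)`. -/
def totalDeriv (f : Jet (Fin N) n → ℝ) (p : Jet (Fin N) n) : ℝ :=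
  fderivWithin ℝ f (jetDomain N n T Q) p
    (1, fun (β : Fin (n + 1)) (j : Fin N) => coord p (β + 1) j)

/-- The Euler-Lagrange operator
`E_i(f) = ∂f/∂q^i + ∑_{β=1}^r (-1)^β (d/dt)^β (∂f/∂q^i_(β))`. -/
def eulerLagrange (r : ℕ) (f : Jet (Fin N) n → ℝ) (i : Fin N) (p : Jet (Fin N) n) : ℝ :=
  partialQ T Q f 0 i p +
    ∑ β ∈ Finset.Icc 1 r, (-1 : ℝ) ^ β * ((totalDeriv T Q)^[β] (partialQ T Q f β i)) p

/-- The function `∑ (-1)^ε (d/dt)^ε (∂f/∂q^i_(δ))`, the sum being over all `1 ≤ δ ≤ r` and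
`0 ≤ ε ≤ δ` with `δ - ε - 1 = β`. -/
def momentum (r : ℕ) (f : Jet (Fin N) n → ℝ) (β : ℕ) (i : Fin N) (p : Jet (Fin N) n) : ℝ :=
  ∑ δ ∈ Finset.Icc 1 r, ∑ ε ∈ Finset.range (δ + 1),
    if δ = β + ε + 1 then
      (-1 : ℝ) ^ ε * ((totalDeriv T Q)^[ε] (partialQ T Q f δ i)) p
    else 0

end JetCalculus

/-! ## Defining triples -/

/-- `K` is the closure of a bounded open subset of `ℝ^M` and its boundary is smooth: near every
boundary point, `K` is a sublevel set of a smooth function without critical points there. -/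
structure IsSmoothDomain {M : ℕ} (K : Set (Fin M → ℝ)) : Prop where
  exists_open : ∃ Ω : Set (Fin M → ℝ), IsOpen Ω ∧ Bornology.IsBounded Ω ∧ K = closure Ω
  smooth_boundary : ∀ x ∈ frontier K, ∃ (V : Set (Fin M → ℝ)) (φ : (Fin M → ℝ) → ℝ),
    IsOpen V ∧ x ∈ V ∧ ContDiffOn ℝ ∞ φ V ∧ (∀ z ∈ V, fderiv ℝ φ z ≠ 0) ∧
      K ∩ V = {z ∈ V | φ z ≤ 0}

/-- A pair `U = (u(·), σ)` formed by a control curve (only its restriction to `[0, T]` matters)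
and by the coordinates `(q_(0), …, q_(2r-1))` of a `(2r-1)`-jet at `t = 0`. -/
structure ControlPair (N M r : ℕ) where
  control : ℝ → Fin M → ℝ
  initial : Fin (2 * r) → Fin N → ℝ

/-- The Lagrangian `L^{u(·)}(t, q_(β)) = L(t, q_(β), u(t))` determined by the control curve `u`. -/
def frozen {N M n : ℕ} (L : Jet (Fin N) n → (Fin M → ℝ) → ℝ) (u : ℝ → Fin M → ℝ) :
    Jet (Fin N) n → ℝ :=
  fun p => L p (u p.1)

/-- `γ` is a (smooth) solution on `[0, T]` of the Euler-Lagrange equations of the Lagrangian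
`L^{u(·)}`, with initial jet `j^{2r-1}_{t=0}(γ) = σ`, where `U = (u(·), σ)`. -/
structure IsSolution {N M n r : ℕ} (T : ℝ) (Q : Set (Fin N → ℝ))
    (L : Jet (Fin N) n → (Fin M → ℝ) → ℝ) (U : ControlPair N M r) (γ : ℝ → Fin N → ℝ) :
    Prop where
  smooth : ContDiffOn ℝ ∞ γ (Icc 0 T)
  mem : ∀ t ∈ Icc 0 T, γ t ∈ Q
  equations : ∀ t ∈ Icc 0 T, ∀ i,
    eulerLagrange T Q r (frozen L U.control) i (jet n T γ t) = 0
  initial : ∀ k : Fin (2 * r), iteratedDerivWithin k γ (Icc 0 T) 0 = U.initial k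

/-- A defining triple `(𝒦, L, C)` with controlled Lagrangian of actual order `r`, on the time
interval `[0, T]`, for a configuration space `Q` with global coordinates `q^1, …, q^N` and a set
`K ⊆ ℝ^M` of control values. -/
structure DefiningTriple (N M n r : ℕ) (T : ℝ) where
  /-- the configuration space -/
  Q : Set (Fin N → ℝ)
  isOpen_Q : IsOpen Q
  /-- the set of control values -/
  K : Set (Fin M → ℝ)
  smoothDomain_K : IsSmoothDomain K
  /-- the controlled Lagrangian -/
  L : Jet (Fin N) n → (Fin M → ℝ) → ℝ
  smooth_L : ContDiffOn ℝ ∞ (fun x : Jet (Fin N) n × (Fin M → ℝ) => L x.1 x.2)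
    (jetDomain N n T Q ×ˢ K)
  order_L : ∀ w ∈ K, HasOrder T Q (fun p => L p w) r
  /-- the extended cost function -/
  C : Jet (Fin N) n → ℝ
  smooth_C : ContDiffOn ℝ ∞ C (jetDomain N n T Q)
  /-- the actual order of `C` -/
  costOrder : ℕ
  order_C : HasOrder T Q C costOrder
  /-- the total derivative `dC/dt` has actual order at most `r` -/
  costOrder_succ_le : costOrder + 1 ≤ r
  C_zero : ∀ p ∈ jetDomain N n T Q, p.1 = 0 → C p = 0
  /-- the set of control parameters -/
  params : Set (ControlPair N M r)
  smooth_control : ∀ U ∈ params, ContDiffOn ℝ ∞ U.control (Icc 0 T)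
  control_mem : ∀ U ∈ params, ∀ t ∈ Icc 0 T, U.control t ∈ K
  /-- each pair in `𝒦` determines a unique controlled curve -/
  existsUnique_solution : ∀ U ∈ params, ∃ γ, IsSolution T Q L U γ ∧
    ∀ γ', IsSolution T Q L U γ' → EqOn γ' γ (Icc 0 T)

/-! ## The enlarged configuration spaces -/

/-- Indices of the coordinates `q^i, h^i_β, h'^i_β, h''^i_β`, `0 ≤ β ≤ r - 1`. -/
inductive TildeIdx (N r : ℕ) : Type
  | q (i : Fin N)
  | h (i : Fin N) (β : Fin r)
  | h' (i : Fin N) (β : Fin r)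
  | h'' (i : Fin N) (β : Fin r)
  deriving DecidableEq, Fintype

/-- Indices of the coordinates `q^i, h^i_β, h'^i_β, h''^i_β, λ, μ`. -/
inductive HatIdx (N r : ℕ) : Type
  | tilde (ℓ : TildeIdx N r)
  | lam
  | mu
  deriving DecidableEq, Fintype

/-- The projection of a jet onto its part with coordinates `q^i_(β)`. -/
def TildeIdx.base {N n r : ℕ} (p : Jet (TildeIdx N r) n) : Jet (Fin N) n :=
  (p.1, fun β i => p.2 β (.q i))

/-- The projection of a jet that forgets the coordinates `λ_(β), μ_(β)`. -/
def HatIdx.toTilde {N n r : ℕ} (p : Jet (HatIdx N r) n) : Jet (TildeIdx N r) n :=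
  (p.1, fun β ℓ => p.2 β (.tilde ℓ))

/-- The function `A e^t + B e^{-t}` with `A + B = a` and `A - B = b`. -/
def expFun (a b t : ℝ) : ℝ :=
  (a + b) / 2 * Real.exp t + (a - b) / 2 * Real.exp (-t)

/-- The matrix of the boundary conditions of `expTrigFun`. -/
def boundaryMatrix (T : ℝ) : Matrix (Fin 4) (Fin 4) ℝ :=
  let k := Real.pi / (2 * T)
  !![1, 1, 1, 0;
     k, -k, 0, k;
     k * Real.exp (Real.pi / 2), -k * Real.exp (-(Real.pi / 2)), -k, 0;
     k ^ 2 * Real.exp (Real.pi / 2), k ^ 2 * Real.exp (-(Real.pi / 2)), 0, -k ^ 2]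

/-- The function `A e^{kt} + B e^{-kt} + C cos(kt) + D sin(kt)`, `k = π/(2T)`, that vanishes with
its first derivative at `t = 0` and has first and second derivatives `a` and `b` at `t = T`. -/
def expTrigFun (T a b t : ℝ) : ℝ :=
  let k := Real.pi / (2 * T)
  let c := (boundaryMatrix T)⁻¹ *ᵥ ![0, 0, a, b]
  c 0 * Real.exp (k * t) + c 1 * Real.exp (-(k * t)) + c 2 * Real.cos (k * t)
    + c 3 * Real.sin (k * t)

namespace DefiningTriple

variable {N M n r : ℕ} {T : ℝ} (D : DefiningTriple N M n r T)

/-- The function `dC/dt`. -/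
def dC : Jet (Fin N) n → ℝ := totalDeriv T D.Q D.C

/-! ### The functions associated with a curve `γ` and a control curve `u` -/

/-- The function `h^i_β`. -/
def hFun (u : ℝ → Fin M → ℝ) (γ : ℝ → Fin N → ℝ) (i : Fin N) (β : Fin r) : ℝ → ℝ :=
  expFun (coord (jet n T γ 0) β i) (-momentum T D.Q r (frozen D.L u) β i (jet n T γ 0))

/-- The function `h'^i_β`. -/
def hFun' (u : ℝ → Fin M → ℝ) (γ : ℝ → Fin N → ℝ) (i : Fin N) (β : Fin r) : ℝ → ℝ :=
  expTrigFun T (coord (jet n T γ T) β i)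
    (momentum T D.Q r (fun p => frozen D.L u p + D.dC p) β i (jet n T γ T))

/-- The function `h''^i_β`. -/
def hFun'' (u : ℝ → Fin M → ℝ) (γ : ℝ → Fin N → ℝ) (i : Fin N) (β : Fin r) : ℝ → ℝ :=
  expTrigFun T (D.hFun u γ i β T) (deriv (D.hFun u γ i β) T)

/-- The curve `(q^i, h^i_β, h'^i_β, h''^i_β)`. -/
def tildeCurve (u : ℝ → Fin M → ℝ) (γ : ℝ → Fin N → ℝ) (t : ℝ) : TildeIdx N r → ℝ
  | .q i => γ t i
  | .h i β => D.hFun u γ i β t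
  | .h' i β => D.hFun' u γ i β t
  | .h'' i β => D.hFun'' u γ i β t

/-- The modified Lagrangian `L̃`. -/
def LTilde (p : Jet (TildeIdx N r) n) (w : Fin M → ℝ) : ℝ :=
  D.L (TildeIdx.base p) w
    + 1 / 2 * ∑ i : Fin N, ∑ β : Fin r,
        (coord p 1 (.h i β) ^ 2 - coord p 2 (.h' i β) ^ 2 - coord p 2 (.h'' i β) ^ 2)
    + ∑ i : Fin N, ∑ β : Fin r,
        (1 / 2 * coord p 0 (.h i β) ^ 2
          + Real.pi ^ 4 / (32 * T ^ 4) * coord p 0 (.h' i β) ^ 2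
          + Real.pi ^ 4 / (32 * T ^ 4) * coord p 0 (.h'' i β) ^ 2)

/-- The `μ`-component `μ(t) = -∫_0^t L̃ dτ`. -/
def muFun (u : ℝ → Fin M → ℝ) (γ : ℝ → Fin N → ℝ) (t : ℝ) : ℝ :=
  -∫ τ in (0 : ℝ)..t, D.LTilde (jet n T (D.tildeCurve u γ) τ) (u τ)

/-- The curve `(q^i, h^i_β, h'^i_β, h''^i_β, λ = 1, μ)`. -/
def hatCurve (u : ℝ → Fin M → ℝ) (γ : ℝ → Fin N → ℝ) (t : ℝ) : HatIdx N r → ℝ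
  | .tilde ℓ => D.tildeCurve u γ t ℓ
  | .lam => 1
  | .mu => D.muFun u γ t

/-! ### The Poincaré-Cartan form -/

/-- The modified Lagrangian `L̂ = λ (μ_(1) + L̃) + dC/dt`. -/
def LHat (p : Jet (HatIdx N r) n) (w : Fin M → ℝ) : ℝ :=
  coord p 0 .lam * (coord p 1 .mu + D.LTilde (HatIdx.toTilde p) w)
    + D.dC (TildeIdx.base (HatIdx.toTilde p))

/-- The value `dy^ℓ_(δ)(v) - y^ℓ_(δ+1) dt(v)` of a contact form at the point `p`. -/
def contactForm (p : Jet (HatIdx N r) n) (ℓ : HatIdx N r) (δ : ℕ) (v : Jet (HatIdx N r) n) : ℝ :=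
  coord v δ ℓ - coord p (δ + 1) ℓ * v.1

/-- The controlled Poincaré-Cartan form along the control curve `u`, as a function of the point
`x` of the product of the jet space and of the control space and of the tangent vector `v` at `x`.
It has no components along the differentials `du^a`. -/
def alphaPC (u : ℝ → Fin M → ℝ) (x v : Jet (HatIdx N r) n × (Fin M → ℝ)) : ℝ :=
  D.LHat x.1 x.2 * v.1.1
    + coord x.1 0 .lam * ∑ i : Fin N, ∑ δ ∈ Finset.Icc 1 r, ∑ ε ∈ Finset.range δ,
        (-1 : ℝ) ^ ε
          * ((totalDeriv T D.Q)^[ε]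
              (partialQ T D.Q (fun p => frozen D.L u p + D.dC p) δ i))
            (TildeIdx.base (HatIdx.toTilde x.1))
          * contactForm x.1 (.tilde (.q i)) (δ - (ε + 1)) v.1
    + coord x.1 0 .lam * ∑ i : Fin N, ∑ β : Fin r,
        (coord x.1 1 (.tilde (.h i β)) * contactForm x.1 (.tilde (.h i β)) 0 v.1
          - coord x.1 2 (.tilde (.h' i β)) * contactForm x.1 (.tilde (.h' i β)) 1 v.1
          - coord x.1 2 (.tilde (.h'' i β)) * contactForm x.1 (.tilde (.h'' i β)) 1 v.1
          + coord x.1 3 (.tilde (.h' i β)) * contactForm x.1 (.tilde (.h' i β)) 0 v.1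
          + coord x.1 3 (.tilde (.h'' i β)) * contactForm x.1 (.tilde (.h'' i β)) 0 v.1)
    + coord x.1 0 .lam * contactForm x.1 .mu 0 v.1

/-! ### Variations -/

/-- The controlled curve `γ^{(U)}`: for `U ∈ 𝒦`, the unique solution determined by `U`. -/
def controlledCurve (U : ControlPair N M r) : ℝ → Fin N → ℝ :=
  Classical.epsilon (IsSolution T D.Q D.L U)

/-- The map `F(t, s) = γ^{(U(s))}(t)`. -/
def variation (U : ℝ → ControlPair N M r) (t s : ℝ) : Fin N → ℝ :=
  D.controlledCurve (U s) t

/-- The curve `s ↦ U(s) = (u(·, s), σ(s))`, `s ∈ [0, 1]`, is a smooth curve in `𝒦`, and the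
controlled curves `γ^{(U(s))}` form a controlled variation, that is a smooth homotopy. -/
structure IsSmoothCurve (U : ℝ → ControlPair N M r) : Prop where
  mem : ∀ s ∈ Icc (0 : ℝ) 1, U s ∈ D.params
  smooth_control : ContDiffOn ℝ ∞ (fun x : ℝ × ℝ => (U x.2).control x.1) (Icc 0 T ×ˢ Icc 0 1)
  smooth_initial : ContDiffOn ℝ ∞ (fun s => (U s).initial) (Icc 0 1)
  smooth_variation : ContDiffOn ℝ ∞ (fun x : ℝ × ℝ => D.variation U x.1 x.2)
    (Icc 0 T ×ˢ Icc 0 1)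

/-- The homotopy `F^{(n)}(t, s) = (j^n_t(γ^{(U(s))}), u(t, s))`. -/
def variationJet (U : ℝ → ControlPair N M r) (t s : ℝ) : Jet (Fin N) n × (Fin M → ℝ) :=
  (jet n T (D.controlledCurve (U s)) t, (U s).control t)

/-- The homotopy `F̂^{(n)}(t, s)` of the jets of the associated curves `γ̂`. -/
def hatJet (U : ℝ → ControlPair N M r) (t s : ℝ) : Jet (HatIdx N r) n × (Fin M → ℝ) :=
  (jet n T (D.hatCurve (U s).control (D.controlledCurve (U s))) t, (U s).control t)

/-- The vector field `Y_F = ∂F^{(n)}/∂s`. -/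
def Y (U : ℝ → ControlPair N M r) (t s : ℝ) : Jet (Fin N) n × (Fin M → ℝ) :=
  derivWithin (fun s' => D.variationJet U t s') (Icc 0 1) s

/-- The vector field `Y_F̂ = ∂F̂^{(n)}/∂s`. -/
def YHat (U : ℝ → ControlPair N M r) (t s : ℝ) : Jet (HatIdx N r) n × (Fin M → ℝ) :=
  derivWithin (fun s' => D.hatJet U t s') (Icc 0 1) s

/-- The function `P_σ(w) = -L(σ, w)` on the set `K` of control values. -/
def P (σ : Jet (Fin N) n) (w : Fin M → ℝ) : ℝ := -D.L σ w

/-- The derivative `∂P_σ/∂u^a`. -/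
def partialP (σ : Jet (Fin N) n) (a : Fin M) (w : Fin M → ℝ) : ℝ :=
  fderivWithin ℝ (D.P σ) D.K w (Pi.single a 1)

/-- The function `μ(t, s)`. -/
def mu (U : ℝ → ControlPair N M r) (t s : ℝ) : ℝ :=
  D.muFun (U s).control (D.controlledCurve (U s)) t

/-- The function `μ'(t, s)`. -/
def mu' (U : ℝ → ControlPair N M r) (t s : ℝ) : ℝ :=
  D.mu U t s + ∑ β : Fin r, ∑ i : Fin N, ∫ v in (0 : ℝ)..s,
    (coord (D.hatJet U t v).1 3 (.tilde (.h' i β)) * coord (D.YHat U t v).1 0 (.tilde (.h' i β))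
      + coord (D.hatJet U t v).1 3 (.tilde (.h'' i β))
        * coord (D.YHat U t v).1 0 (.tilde (.h'' i β)))

/-- The mixed derivative `∂²μ'/∂t∂s`. -/
def mixedDerivMu' (U : ℝ → ControlPair N M r) (t s : ℝ) : ℝ :=
  derivWithin (fun t' => derivWithin (fun s' => D.mu' U t' s') (Icc 0 1) s) (Icc 0 T) t

/-- The terminal cost of the controlled curve `γ^{(U)}`. -/
def terminalCost (U : ControlPair N M r) : ℝ :=
  D.C (jet n T (D.controlledCurve U) T)

end DefiningTriple

end GeneralisedMayer

end

/-! The proof compares boundary terms of first variation formulas. Write δ for the derivative in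
`s`, and consider along the homotopy B = Σ π^β_i(L^u) δq^i_(β) (`lagrangianPairing`), the
corresponding boundary term H of the auxiliary Lagrangian in h, h', h'' (`auxPairing`), and W = Σ
(h'_(3) δh' + h''_(3) δh'') (`muCorrection`), which is the correction that turns δμ into δμ'.

Three differential identities carry the argument. Since each q is an extremal of its frozen
Lagrangian, ∂B/∂t is the variation of L due to the jets alone (`dt_lagrangianPairing`), so Σ Y^a
∂P/∂u^a = ∂B/∂t − δL (`sum_control_variation`). The auxiliary functions solve h_(2) = h and h'_(4) =
k⁴ h', h''_(4) = k⁴ h'', the Euler–Lagrange equations of the auxiliary Lagrangian A, so ∂H/∂t = δA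
(`dt_auxPairing`). Finally L̃ = L + A along the curves and ∂²μ'/∂t∂s = −δL̃ + ∂W/∂t
(`mixedDerivMu'_eq`). Hence the integrand of (i) is exactly ∂(B + H − W)/∂t.

The boundary conditions are made to evaluate B + H − W at the two ends. At t = 0, h encodes (q_(β),
−π^β) while h' and h'' vanish to first order, so H = −B and W = 0 (`auxPairing_zero`,
`muCorrection_zero`). At t = T, h' encodes (q_(β), π^β(L^u + dC/dt)) and h'' reproduces h, so H = W
− Σ π^β_i(L^u + dC/dt) δq^i_(β) (`auxPairing_right`). The momenta of dC/dt are the derivatives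
∂C/∂q_(β) (`momentum_totalDeriv`), so the last sum is B + δC (`totalPairing_eq`). Thus B + H − W
goes from 0 to −δC, and Fubini followed by integration in `s` gives (i).

For (ii), α^PC evaluated on Y is B + δC + H − ∫₀ᵗ δL̃ (`alphaPC_YHat`). It vanishes at t = 0,
because C is zero on all initial jets, and equals W − ∫₀ᵀ δL̃ at t = T, which is the integral of
∂²μ'/∂t∂s. -/

noncomputable section

namespace GeneralisedMayer

/-! ## Calculus on a rectangle -/

section Rectangle

variable {E : Type*} [NormedAddCommGroup E] [NormedSpace ℝ E] {T : ℝ}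

/-- The map `f` of two variables is smooth on the rectangle `[0, T] × [0, 1]`. -/
def SmoothOnRect (T : ℝ) (f : ℝ → ℝ → E) : Prop :=
  ContDiffOn ℝ ∞ (Function.uncurry f) (Icc 0 T ×ˢ Icc (0 : ℝ) 1)

/-- The partial derivative in the first variable, over `[0, T]`. -/
def dt (T : ℝ) (f : ℝ → ℝ → E) (t s : ℝ) : E :=
  derivWithin (fun t' => f t' s) (Icc 0 T) t

/-- The partial derivative in the second variable, over `[0, 1]`. -/
def ds (f : ℝ → ℝ → E) (t s : ℝ) : E :=
  derivWithin (fun s' => f t s') (Icc 0 1) s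

/-- The iterated partial derivative in the first variable, over `[0, T]`. -/
def dtn (T : ℝ) (k : ℕ) (f : ℝ → ℝ → E) (t s : ℝ) : E :=
  iteratedDerivWithin k (fun t' => f t' s) (Icc 0 T) t

@[simp] lemma dtn_zero (f : ℝ → ℝ → E) : dtn T 0 f = f := by
  ext t s; simp [dtn]

lemma dtn_succ (k : ℕ) (f : ℝ → ℝ → E) : dtn T (k + 1) f = dt T (dtn T k f) := by
  ext t s; simp only [dtn, dt, iteratedDerivWithin_succ]

lemma uniqueDiffOn_rect (hT : 0 < T) : UniqueDiffOn ℝ (Icc 0 T ×ˢ Icc (0 : ℝ) 1) :=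
  (uniqueDiffOn_Icc hT).prod (uniqueDiffOn_Icc zero_lt_one)

lemma rect_subset_closure_interior (hT : 0 < T) :
    Icc 0 T ×ˢ Icc (0 : ℝ) 1 ⊆ closure (interior (Icc 0 T ×ˢ Icc (0 : ℝ) 1)) := by
  rw [interior_prod_eq, closure_prod_eq, interior_Icc, interior_Icc, closure_Ioo hT.ne,
    closure_Ioo zero_ne_one]

namespace SmoothOnRect

variable {f g : ℝ → ℝ → E} {t s : ℝ}

lemma fderiv_apply (hT : 0 < T) (hf : SmoothOnRect T f) (v : ℝ × ℝ) :
    SmoothOnRect T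
      (fun t s => fderivWithin ℝ (Function.uncurry f) (Icc 0 T ×ˢ Icc (0 : ℝ) 1) (t, s) v) := by
  have := hf.fderivWithin (m := ∞) (uniqueDiffOn_rect hT) (by simp)
  exact this.clm_apply contDiffOn_const

lemma differentiableWithinAt (hf : SmoothOnRect T f) (ht : t ∈ Icc 0 T) (hs : s ∈ Icc (0 : ℝ) 1) :
    DifferentiableWithinAt ℝ (Function.uncurry f) (Icc 0 T ×ˢ Icc (0 : ℝ) 1) (t, s) :=
  hf.differentiableOn (by simp) _ ⟨ht, hs⟩

lemma hasDerivWithinAt_fst_aux (hf : SmoothOnRect T f) (ht : t ∈ Icc 0 T)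
    (hs : s ∈ Icc (0 : ℝ) 1) : HasDerivWithinAt (fun t' => f t' s)
      (fderivWithin ℝ (Function.uncurry f) (Icc 0 T ×ˢ Icc (0 : ℝ) 1) (t, s) (1, 0))
      (Icc 0 T) t :=
  (hf.differentiableWithinAt ht hs).hasFDerivWithinAt.comp_hasDerivWithinAt t
    (f := fun t' => (t', s))
    ((hasDerivWithinAt_id t _).prodMk (hasDerivWithinAt_const t _ s)) (fun _ h => ⟨h, hs⟩)

lemma hasDerivWithinAt_snd_aux (hf : SmoothOnRect T f) (ht : t ∈ Icc 0 T)
    (hs : s ∈ Icc (0 : ℝ) 1) : HasDerivWithinAt (fun s' => f t s')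
      (fderivWithin ℝ (Function.uncurry f) (Icc 0 T ×ˢ Icc (0 : ℝ) 1) (t, s) (0, 1))
      (Icc 0 1) s :=
  (hf.differentiableWithinAt ht hs).hasFDerivWithinAt.comp_hasDerivWithinAt s
    (f := fun s' => (t, s'))
    ((hasDerivWithinAt_const s _ t).prodMk (hasDerivWithinAt_id s _)) (fun _ h => ⟨ht, h⟩)

lemma dt_eq (hT : 0 < T) (hf : SmoothOnRect T f) (ht : t ∈ Icc 0 T) (hs : s ∈ Icc (0 : ℝ) 1) :
    dt T f t s =
      fderivWithin ℝ (Function.uncurry f) (Icc 0 T ×ˢ Icc (0 : ℝ) 1) (t, s) (1, 0) :=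
  (hf.hasDerivWithinAt_fst_aux ht hs).derivWithin (uniqueDiffOn_Icc hT t ht)

lemma ds_eq (hf : SmoothOnRect T f) (ht : t ∈ Icc 0 T) (hs : s ∈ Icc (0 : ℝ) 1) :
    ds f t s =
      fderivWithin ℝ (Function.uncurry f) (Icc 0 T ×ˢ Icc (0 : ℝ) 1) (t, s) (0, 1) :=
  (hf.hasDerivWithinAt_snd_aux ht hs).derivWithin (uniqueDiffOn_Icc zero_lt_one s hs)

lemma hasDerivWithinAt_fst (hT : 0 < T) (hf : SmoothOnRect T f) (ht : t ∈ Icc 0 T)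
    (hs : s ∈ Icc (0 : ℝ) 1) :
    HasDerivWithinAt (fun t' => f t' s) (dt T f t s) (Icc 0 T) t := by
  rw [hf.dt_eq hT ht hs]; exact hf.hasDerivWithinAt_fst_aux ht hs

lemma hasDerivWithinAt_snd (hf : SmoothOnRect T f) (ht : t ∈ Icc 0 T)
    (hs : s ∈ Icc (0 : ℝ) 1) :
    HasDerivWithinAt (fun s' => f t s') (ds f t s) (Icc 0 1) s := by
  rw [hf.ds_eq ht hs]; exact hf.hasDerivWithinAt_snd_aux ht hs

lemma congr (hf : SmoothOnRect T f)
    (h : ∀ t ∈ Icc 0 T, ∀ s ∈ Icc (0 : ℝ) 1, g t s = f t s) : SmoothOnRect T g :=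
  ContDiffOn.congr hf fun x hx => h x.1 hx.1 x.2 hx.2

lemma dt (hT : 0 < T) (hf : SmoothOnRect T f) : SmoothOnRect T (dt T f) :=
  (hf.fderiv_apply hT (1, 0)).congr fun _ ht _ hs => hf.dt_eq hT ht hs

lemma ds (hT : 0 < T) (hf : SmoothOnRect T f) : SmoothOnRect T (ds f) :=
  (hf.fderiv_apply hT (0, 1)).congr fun _ ht _ hs => hf.ds_eq ht hs

lemma dtn (hT : 0 < T) (hf : SmoothOnRect T f) (k : ℕ) : SmoothOnRect T (dtn T k f) := by
  induction k with
  | zero => simpa using hf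
  | succ k ih => rw [dtn_succ]; exact ih.dt hT

lemma fst (hf : SmoothOnRect T f) (hs : s ∈ Icc (0 : ℝ) 1) :
    ContDiffOn ℝ ∞ (fun t => f t s) (Icc 0 T) :=
  ContDiffOn.comp hf (f := fun t => (t, s)) (by fun_prop) fun _ h => ⟨h, hs⟩

lemma snd (hf : SmoothOnRect T f) (ht : t ∈ Icc 0 T) :
    ContDiffOn ℝ ∞ (fun s => f t s) (Icc 0 1) :=
  ContDiffOn.comp hf (f := fun s => (t, s)) (by fun_prop) fun _ h => ⟨ht, h⟩

lemma of_snd {c : ℝ → E} (hc : ContDiffOn ℝ ∞ c (Icc 0 1)) :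
    SmoothOnRect T (fun _ s => c s) :=
  ContDiffOn.comp hc (f := fun x : ℝ × ℝ => x.2) (by fun_prop) fun _ h => h.2

lemma add (hf : SmoothOnRect T f) (hg : SmoothOnRect T g) :
    SmoothOnRect T (fun t s => f t s + g t s) := ContDiffOn.add hf hg

lemma sub (hf : SmoothOnRect T f) (hg : SmoothOnRect T g) :
    SmoothOnRect T (fun t s => f t s - g t s) := ContDiffOn.sub hf hg

lemma neg (hf : SmoothOnRect T f) : SmoothOnRect T (fun t s => - f t s) := ContDiffOn.neg hf

lemma mul {f g : ℝ → ℝ → ℝ} (hf : SmoothOnRect T f) (hg : SmoothOnRect T g) :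
    SmoothOnRect T (fun t s => f t s * g t s) := ContDiffOn.mul hf hg

lemma pow {f : ℝ → ℝ → ℝ} (hf : SmoothOnRect T f) (k : ℕ) :
    SmoothOnRect T (fun t s => f t s ^ k) := ContDiffOn.pow hf k

lemma sum {ι : Type*} {u : Finset ι} {f : ι → ℝ → ℝ → E} (hf : ∀ i ∈ u, SmoothOnRect T (f i)) :
    SmoothOnRect T (fun t s => ∑ i ∈ u, f i t s) := ContDiffOn.sum hf

lemma const (c : E) : SmoothOnRect T (fun _ _ => c) := contDiffOn_const

lemma of_fst {c : ℝ → E} (hc : ContDiff ℝ ∞ c) : SmoothOnRect T (fun t _ => c t) :=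
  (hc.comp contDiff_fst).contDiffOn

lemma continuousOn (hf : SmoothOnRect T f) :
    ContinuousOn (Function.uncurry f) (Icc 0 T ×ˢ Icc (0 : ℝ) 1) := ContDiffOn.continuousOn hf

/-- Mixed partial derivatives commute. -/
lemma ds_dt (hT : 0 < T) (hf : SmoothOnRect T f) (ht : t ∈ Icc 0 T) (hs : s ∈ Icc (0 : ℝ) 1) :
    GeneralisedMayer.ds (GeneralisedMayer.dt T f) t s =
      GeneralisedMayer.dt T (GeneralisedMayer.ds f) t s := by
  set R := Icc 0 T ×ˢ Icc (0 : ℝ) 1 with hR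
  have hu := uniqueDiffOn_rect hT
  have hmem : (t, s) ∈ R := ⟨ht, hs⟩
  -- Evaluation at a fixed vector is linear, so both iterated partials are values of the second
  -- derivative. Its symmetry holds up to the boundary because the rectangle lies in the closure of
  -- its interior.
  have key : ∀ v w : ℝ × ℝ, fderivWithin ℝ (Function.uncurry fun t s =>
      fderivWithin ℝ (Function.uncurry f) R (t, s) v) R (t, s) w =
      fderivWithin ℝ (fderivWithin ℝ (Function.uncurry f) R) R (t, s) w v := by
    intro v w
    have hd : DifferentiableWithinAt ℝ (fderivWithin ℝ (Function.uncurry f) R) R (t, s) :=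
      (ContDiffOn.fderivWithin hf (m := ∞) hu (by simp)).differentiableOn (by simp) _ hmem
    have := (hd.hasFDerivWithinAt.clm_apply (hasFDerivWithinAt_const v (t, s) R)).fderivWithin
      (hu _ hmem)
    have h3 := congrArg (fun A => A w) this
    simp only [ContinuousLinearMap.comp_zero, zero_add, ContinuousLinearMap.flip_apply] at h3
    exact h3
  have h1 : GeneralisedMayer.ds (GeneralisedMayer.dt T f) t s = GeneralisedMayer.ds
      (fun t s => fderivWithin ℝ (Function.uncurry f) R (t, s) (1, 0)) t s :=
    derivWithin_congr (fun s' hs' => hf.dt_eq hT ht hs') (hf.dt_eq hT ht hs)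
  have h2 : GeneralisedMayer.dt T (GeneralisedMayer.ds f) t s = GeneralisedMayer.dt T
      (fun t s => fderivWithin ℝ (Function.uncurry f) R (t, s) (0, 1)) t s :=
    derivWithin_congr (fun t' ht' => hf.ds_eq ht' hs) (hf.ds_eq ht hs)
  rw [h1, h2, (hf.fderiv_apply hT _).ds_eq ht hs, (hf.fderiv_apply hT _).dt_eq hT ht hs, key, key]
  refine ContDiffWithinAt.isSymmSndFDerivWithinAt (n := ∞) (hf _ hmem) ?_ hu
    (rect_subset_closure_interior hT hmem) hmem _ _
  simp only [minSmoothness_of_isRCLikeNormedField]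
  exact WithTop.coe_le_coe.2 (le_top : (2 : ℕ∞) ≤ ⊤)

lemma ds_dtn_succ (hT : 0 < T) (hf : SmoothOnRect T f) (k : ℕ) (ht : t ∈ Icc 0 T)
    (hs : s ∈ Icc (0 : ℝ) 1) :
    GeneralisedMayer.ds (GeneralisedMayer.dtn T (k + 1) f) t s =
      GeneralisedMayer.dt T (GeneralisedMayer.ds (GeneralisedMayer.dtn T k f)) t s := by
  rw [dtn_succ]; exact (hf.dtn hT k).ds_dt hT ht hs

end SmoothOnRect

/-! ### One-sided fundamental theorem of calculus and Fubini on the rectangle -/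

lemma hasDerivWithinAt_integral_of_continuousOn {a b : ℝ} {g : ℝ → ℝ}
    (hab : a ≤ b) (hg : ContinuousOn g (Icc a b)) {x : ℝ} (hx : x ∈ Icc a b) :
    HasDerivWithinAt (fun y => ∫ v in a..y, g v) (g x) (Icc a b) x := by
  -- Extending `g` by its end values gives a continuous function on the line, so the two-sided
  -- theorem applies even at `a` and `b`.
  have hc : Continuous (IccExtend hab ((Icc a b).domRestrict g)) :=
    (continuousOn_iff_continuous_domRestrict.1 hg).Icc_extend'
  have he : ∀ y ∈ Icc a b, IccExtend hab ((Icc a b).domRestrict g) y = g y := fun y hy => by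
    rw [IccExtend_of_mem _ _ hy]; rfl
  have h := (intervalIntegral.integral_hasDerivAt_right (hc.intervalIntegrable a x)
    (hc.stronglyMeasurableAtFilter _ _) hc.continuousAt).hasDerivWithinAt (s := Icc a b)
  rw [he x hx] at h
  have hint : ∀ y ∈ Icc a b, ∫ v in a..y, g v =
      ∫ v in a..y, IccExtend hab ((Icc a b).domRestrict g) v := fun y hy =>
    intervalIntegral.integral_congr fun v hv => by
      rw [uIcc_of_le hy.1] at hv
      exact (he v ⟨hv.1, hv.2.trans hy.2⟩).symm
  exact h.congr hint (hint x hx)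

lemma integral_of_hasDerivWithinAt {a b : ℝ} {g g' : ℝ → ℝ} (hab : a ≤ b)
    (hg' : ContinuousOn g' (Icc a b))
    (hg : ∀ x ∈ Icc a b, HasDerivWithinAt g (g' x) (Icc a b) x) :
    ∫ x in a..b, g' x = g b - g a :=
  intervalIntegral.integral_eq_sub_of_hasDerivAt_of_le hab
    (fun x hx => (hg x hx).continuousWithinAt)
    (fun x hx => (hg x (Ioo_subset_Icc_self hx)).hasDerivAt (Icc_mem_nhds hx.1 hx.2))
    (hg'.intervalIntegrable_of_Icc hab)

lemma continuousOn_integral_fst {a : ℝ} (ha : a ∈ Icc 0 T) {f : ℝ → ℝ → ℝ}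
    (hf : ContinuousOn (Function.uncurry f) (Icc 0 T ×ˢ Icc (0 : ℝ) 1)) :
    ContinuousOn (fun s => ∫ t in (0 : ℝ)..a, f t s) (Icc 0 1) := by
  have hT : 0 ≤ T := ha.1.trans ha.2
  have hc : Continuous (Function.uncurry fun (s t : ℝ) =>
      f (projIcc 0 T hT t) (projIcc 0 1 zero_le_one s)) :=
    ContinuousOn.comp_continuous hf
      (f := fun x : ℝ × ℝ => (((projIcc 0 T hT x.2 : ℝ), (projIcc 0 1 zero_le_one x.1 : ℝ))))
      (by fun_prop) fun x => ⟨Subtype.mem _, Subtype.mem _⟩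
  refine (intervalIntegral.continuous_parametric_intervalIntegral_of_continuous' hc
    0 a).continuousOn.congr fun s hs => intervalIntegral.integral_congr fun t ht => ?_
  rw [uIcc_of_le ha.1] at ht
  simp only [projIcc_of_mem zero_le_one hs, projIcc_of_mem hT ⟨ht.1, ht.2.trans ha.2⟩]

lemma integral_swap_rect {a b : ℝ} (ha : a ∈ Icc 0 T) (hb : b ∈ Icc (0 : ℝ) 1) {f : ℝ → ℝ → ℝ}
    (hf : ContinuousOn (Function.uncurry f) (Icc 0 T ×ˢ Icc (0 : ℝ) 1)) :
    ∫ t in (0 : ℝ)..a, ∫ s in (0 : ℝ)..b, f t s = ∫ s in (0 : ℝ)..b, ∫ t in (0 : ℝ)..a, f t s := by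
  simp only [intervalIntegral.integral_of_le ha.1, intervalIntegral.integral_of_le hb.1]
  refine MeasureTheory.integral_integral_swap ?_
  rw [MeasureTheory.Measure.prod_restrict]
  have hc : IsCompact (Icc 0 T ×ˢ Icc (0 : ℝ) 1) := isCompact_Icc.prod isCompact_Icc
  exact (hf.integrableOn_compact hc).mono_set
    (prod_mono (fun x hx => ⟨hx.1.le, hx.2.trans ha.2⟩) fun x hx => ⟨hx.1.le, hx.2.trans hb.2⟩)

namespace SmoothOnRect

variable {f : ℝ → ℝ → ℝ} {t s : ℝ}

lemma continuousOn_fst (hf : SmoothOnRect T f) (hs : s ∈ Icc (0 : ℝ) 1) :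
    ContinuousOn (fun t => f t s) (Icc 0 T) := (hf.fst hs).continuousOn

lemma continuousOn_snd (hf : SmoothOnRect T f) (ht : t ∈ Icc 0 T) :
    ContinuousOn (fun s => f t s) (Icc 0 1) := (hf.snd ht).continuousOn

lemma integral_dt (hT : 0 < T) (hf : SmoothOnRect T f) (hs : s ∈ Icc (0 : ℝ) 1) :
    ∫ t in (0 : ℝ)..T, GeneralisedMayer.dt T f t s = f T s - f 0 s :=
  integral_of_hasDerivWithinAt hT.le ((hf.dt hT).continuousOn_fst hs)
    fun _ hx => hf.hasDerivWithinAt_fst hT hx hs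

lemma integral_ds (hT : 0 < T) (hf : SmoothOnRect T f) (ht : t ∈ Icc 0 T) :
    ∫ s in (0 : ℝ)..1, GeneralisedMayer.ds f t s = f t 1 - f t 0 :=
  integral_of_hasDerivWithinAt zero_le_one ((hf.ds hT).continuousOn_snd ht)
    fun _ hx => hf.hasDerivWithinAt_snd ht hx

/-- Differentiation under the integral sign. -/
lemma hasDerivWithinAt_integral (hT : 0 < T) (hf : SmoothOnRect T f) (ht : t ∈ Icc 0 T)
    (hs : s ∈ Icc (0 : ℝ) 1) :
    HasDerivWithinAt (fun s => ∫ τ in (0 : ℝ)..t, f τ s)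
      (∫ τ in (0 : ℝ)..t, GeneralisedMayer.ds f τ s) (Icc 0 1) s := by
  have hc := (hf.ds hT).continuousOn
  have h0 : (0 : ℝ) ∈ Icc (0 : ℝ) 1 := ⟨le_rfl, zero_le_one⟩
  have hsub : ∀ s ∈ Icc (0 : ℝ) 1, IntervalIntegrable (fun τ => f τ s) MeasureTheory.volume 0 t :=
    fun s hs => ((hf.continuousOn_fst hs).mono
      (Icc_subset_Icc_right ht.2)).intervalIntegrable_of_Icc ht.1
  -- After Fubini the dependence on `s` sits only in the upper limit of an integral with continuous
  -- integrand, so the fundamental theorem differentiates it.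
  have key : ∀ s ∈ Icc (0 : ℝ) 1, ∫ τ in (0 : ℝ)..t, f τ s =
      (∫ v in (0 : ℝ)..s, ∫ τ in (0 : ℝ)..t, GeneralisedMayer.ds f τ v)
        + ∫ τ in (0 : ℝ)..t, f τ 0 := by
    intro s hs
    rw [← integral_swap_rect ht hs hc, ← sub_eq_iff_eq_add,
      ← intervalIntegral.integral_sub (hsub s hs) (hsub 0 h0)]
    refine intervalIntegral.integral_congr fun τ hτ => ?_
    rw [uIcc_of_le ht.1] at hτ
    have hτ' : τ ∈ Icc 0 T := ⟨hτ.1, hτ.2.trans ht.2⟩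
    refine (integral_of_hasDerivWithinAt hs.1 (((hf.ds hT).continuousOn_snd hτ').mono
      (Icc_subset_Icc_right hs.2)) fun x hx => ?_).symm
    exact (hf.hasDerivWithinAt_snd hτ' ⟨hx.1, hx.2.trans hs.2⟩).mono (Icc_subset_Icc_right hs.2)
  have := (hasDerivWithinAt_integral_of_continuousOn zero_le_one
    (continuousOn_integral_fst ht hc) hs).add_const (∫ τ in (0 : ℝ)..t, f τ 0)
  exact this.congr key (key s hs)

end SmoothOnRect

end Rectangle

/-! ## Calculus on the jet space -/

section JetSpace

variable {N n r k : ℕ} {T : ℝ} {Q : Set (Fin N → ℝ)}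

lemma isOpen_setOf_jet_mem (hQ : IsOpen Q) :
    IsOpen {y : Fin (n + 1) → Fin N → ℝ | y 0 ∈ Q} :=
  hQ.preimage (continuous_apply 0)

lemma jetDomain_eq_prod :
    jetDomain N n T Q = Icc 0 T ×ˢ {y : Fin (n + 1) → Fin N → ℝ | y 0 ∈ Q} := rfl

lemma uniqueDiffOn_jetDomain (hT : 0 < T) (hQ : IsOpen Q) :
    UniqueDiffOn ℝ (jetDomain N n T Q) :=
  (uniqueDiffOn_Icc hT).prod (isOpen_setOf_jet_mem hQ).uniqueDiffOn

lemma jetDomain_subset_closure_interior (hT : 0 < T) (hQ : IsOpen Q) :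
    jetDomain N n T Q ⊆ closure (interior (jetDomain N n T Q)) := by
  rw [jetDomain_eq_prod, interior_prod_eq, closure_prod_eq, interior_Icc,
    (isOpen_setOf_jet_mem hQ).interior_eq, closure_Ioo hT.ne]
  exact prod_mono le_rfl subset_closure

/-- The vector `∂/∂q^i_(β)`. -/
def unitQ (N n β : ℕ) (i : Fin N) : Jet (Fin N) n :=
  (0, fun (β' : Fin (n + 1)) (j : Fin N) => if (β' : ℕ) = β ∧ j = i then 1 else 0)

/-- The linear map that shifts the jet coordinates. -/
def shift (N n : ℕ) : Jet (Fin N) n →ₗ[ℝ] Jet (Fin N) n where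
  toFun p := (0, fun (β : Fin (n + 1)) (j : Fin N) => coord p (β + 1) j)
  map_add' p p' := by
    ext β j
    · simp
    · by_cases h : (β : ℕ) < n <;> simp [coord, h]
  map_smul' c p := by
    ext β j
    · simp
    · by_cases h : (β : ℕ) < n <;> simp [coord, h]

/-- The linear map that shifts the jet coordinates, as a continuous linear map. -/
def shiftL (N n : ℕ) : Jet (Fin N) n →L[ℝ] Jet (Fin N) n :=
  LinearMap.toContinuousLinearMap (shift N n)

lemma partialQ_def (f : Jet (Fin N) n → ℝ) (β : ℕ) (i : Fin N) (p : Jet (Fin N) n) :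
    partialQ T Q f β i p = fderivWithin ℝ f (jetDomain N n T Q) p (unitQ N n β i) := rfl

lemma totalDeriv_def (f : Jet (Fin N) n → ℝ) (p : Jet (Fin N) n) :
    totalDeriv T Q f p = fderivWithin ℝ f (jetDomain N n T Q) p ((1, 0) + shiftL N n p) := by
  simp only [totalDeriv, shiftL, LinearMap.coe_toContinuousLinearMap']
  congr 1
  ext β j <;> simp [shift]

lemma shiftL_unitQ_succ (δ : ℕ) (hδ : δ < n) (i : Fin N) :
    shiftL N n (unitQ N n (δ + 1) i) = unitQ N n δ i := by
  simp only [shiftL, LinearMap.coe_toContinuousLinearMap']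
  ext β j
  · simp [shift, unitQ]
  · by_cases h : (β : ℕ) < n
    · simp [shift, unitQ, coord, h]
    · have : (β : ℕ) ≠ δ := by omega
      simp [shift, unitQ, coord, h, this]

/-- A function that is constant near `p` on a line has zero derivative along that line. -/
lemma fderivWithin_apply_eq_zero {f : Jet (Fin N) n → ℝ} {X : Set (Jet (Fin N) n)}
    {p v : Jet (Fin N) n}
    (h : ∀ᶠ τ : ℝ in nhds 0, p + τ • v ∈ X ∧ f (p + τ • v) = f p) :
    fderivWithin ℝ f X p v = 0 := by
  by_cases hd : DifferentiableWithinAt ℝ f X p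
  · have h1 : HasDerivWithinAt (fun τ : ℝ => p + τ • v) v {τ | p + τ • v ∈ X} 0 := by
      have := ((hasDerivAt_id (0 : ℝ)).smul_const v).const_add p
      simpa using this.hasDerivWithinAt
    have hd' : HasFDerivWithinAt f (fderivWithin ℝ f X p) X (p + (0 : ℝ) • v) := by
      simpa using hd.hasFDerivWithinAt
    have h2 := (hd'.comp_hasDerivWithinAt (0 : ℝ) h1 fun _ hτ => hτ).hasDerivAt
      (h.mono fun _ hτ => hτ.1)
    have h3 : HasDerivAt (f ∘ fun τ : ℝ => p + τ • v) 0 0 :=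
      (hasDerivAt_const (0 : ℝ) (f p)).congr_of_eventuallyEq (h.mono fun _ hτ => hτ.2)
    exact h2.unique h3
  -- The default value `0` of `fderivWithin` makes a differentiability hypothesis superfluous.
  · rw [fderivWithin_zero_of_not_differentiableWithinAt hd]; rfl

lemma eventually_add_smul_mem_jetDomain (hQ : IsOpen Q) {p v : Jet (Fin N) n}
    (hp : p ∈ jetDomain N n T Q) (hv : v.1 = 0) :
    ∀ᶠ τ : ℝ in nhds 0, p + τ • v ∈ jetDomain N n T Q := by
  have hc : Continuous fun τ : ℝ => (p + τ • v).2 0 := by fun_prop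
  have h0 : (p + (0 : ℝ) • v).2 0 ∈ Q := by simpa using hp.2
  filter_upwards [(hQ.preimage hc).mem_nhds h0] with τ hτ
  exact ⟨by simpa [hv] using hp.1, hτ⟩

/-! ### Functions of given order -/

namespace HasOrder

variable {f g : Jet (Fin N) n → ℝ}

lemma mono {k' : ℕ} (hf : HasOrder T Q f k) (h : k ≤ k') : HasOrder T Q f k' :=
  fun p hp p' hp' h1 h2 => hf p hp p' hp' h1 fun β hβ => h2 β (hβ.trans h)

lemma const_mul (hf : HasOrder T Q f k) (c : ℝ) : HasOrder T Q (fun p => c * f p) k :=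
  fun p hp p' hp' h1 h2 => by simp only [hf p hp p' hp' h1 h2]

lemma sum {ι : Type*} {u : Finset ι} {f : ι → Jet (Fin N) n → ℝ}
    (hf : ∀ i ∈ u, HasOrder T Q (f i) k) : HasOrder T Q (fun p => ∑ i ∈ u, f i p) k :=
  fun p hp p' hp' h1 h2 => Finset.sum_congr rfl fun i hi => hf i hi p hp p' hp' h1 h2

lemma fderivWithin_apply_eq_zero (hQ : IsOpen Q) (hf : HasOrder T Q f k) {p v : Jet (Fin N) n}
    (hp : p ∈ jetDomain N n T Q) (hv : v.1 = 0)
    (hv' : ∀ β : Fin (n + 1), (β : ℕ) ≤ k → v.2 β = 0) :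
    fderivWithin ℝ f (jetDomain N n T Q) p v = 0 := by
  refine GeneralisedMayer.fderivWithin_apply_eq_zero ?_
  filter_upwards [eventually_add_smul_mem_jetDomain hQ hp hv] with τ hτ
  exact ⟨hτ, hf _ hτ _ hp (by simp [hv]) fun β hβ => by simp [hv' β hβ]⟩

lemma partialQ_eq_zero (hQ : IsOpen Q) (hf : HasOrder T Q f k) {p : Jet (Fin N) n}
    (hp : p ∈ jetDomain N n T Q) {δ : ℕ} (hδ : k < δ) (i : Fin N) :
    partialQ T Q f δ i p = 0 :=
  hf.fderivWithin_apply_eq_zero hQ hp rfl fun β hβ => by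
    have : (β : ℕ) ≠ δ := by omega
    ext j; simp [this]

-- Two such points differ by a vector `d` with zero time part and zero slots up to `k`. Translation
-- by `d` preserves the jet domain, since slot `0` is untouched, and preserves `f`; hence it
-- preserves the derivative as well.
open scoped Pointwise in
lemma fderivWithin_eq (hf : HasOrder T Q f k) {p p' : Jet (Fin N) n}
    (hp : p ∈ jetDomain N n T Q) (h1 : p.1 = p'.1)
    (h2 : ∀ β : Fin (n + 1), (β : ℕ) ≤ k → p.2 β = p'.2 β) :
    fderivWithin ℝ f (jetDomain N n T Q) p = fderivWithin ℝ f (jetDomain N n T Q) p' := by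
  obtain ⟨d, rfl⟩ : ∃ d, p' = p + d := ⟨p' - p, by abel⟩
  have hd1 : d.1 = 0 := by simpa using h1
  have hd2 : ∀ β : Fin (n + 1), (β : ℕ) ≤ k → d.2 β = 0 := fun β hβ => by simpa using h2 β hβ
  have hX : ∀ x, x + d ∈ jetDomain N n T Q ↔ x ∈ jetDomain N n T Q := fun x => by
    simp [jetDomain, hd1, hd2 0 (Nat.zero_le _)]
  have hset : d +ᵥ jetDomain N n T Q = jetDomain N n T Q := by
    ext x
    rw [mem_vadd_set_iff_neg_vadd_mem, vadd_eq_add, ← hX, neg_add_cancel_comm]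
  have hcomp := fderivWithin_comp_add_right (𝕜 := ℝ) (f := f) (s := jetDomain N n T Q) (x := p) d
  rw [hset] at hcomp
  rw [← hcomp]
  exact (fderivWithin_congr (fun x hx => hf _ ((hX x).2 hx) _ hx (by simp [hd1])
    fun β hβ => by simp [hd2 β hβ]) (hf _ ((hX p).2 hp) _ hp (by simp [hd1])
    fun β hβ => by simp [hd2 β hβ])).symm

lemma partialQ (hf : HasOrder T Q f k) (β : ℕ) (i : Fin N) :
    HasOrder T Q (partialQ T Q f β i) k := fun p hp p' _ h1 h2 => by
  rw [partialQ_def, partialQ_def, hf.fderivWithin_eq hp h1 h2]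

/-- The derivative of `f` itself depends on slots up to `k`, and it only sees the slots up to `k` of
the vector it is applied to. In the total derivative these are filled by the coordinates up to `k +
1`. -/
lemma totalDeriv (hQ : IsOpen Q) (hf : HasOrder T Q f k) :
    HasOrder T Q (totalDeriv T Q f) (k + 1) := fun p hp p' hp' h1 h2 => by
  rw [totalDeriv_def, totalDeriv_def,
    hf.fderivWithin_eq hp h1 fun β hβ => h2 β (hβ.trans (Nat.le_succ k)), ← sub_eq_zero,
    ← map_sub]
  refine hf.fderivWithin_apply_eq_zero hQ hp' ?_ fun β hβ => ?_
  · simp [shiftL, shift]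
  · ext j
    by_cases h : (β : ℕ) < n
    · have := congrFun (h2 ⟨β + 1, by omega⟩ (by simpa using hβ)) j
      simp only [shiftL, LinearMap.coe_toContinuousLinearMap']
      simp [shift, coord, h, this]
    · simp only [shiftL, LinearMap.coe_toContinuousLinearMap']
      simp [shift, coord, h]

lemma iterate_totalDeriv (hQ : IsOpen Q) (hf : HasOrder T Q f k) (m : ℕ) :
    HasOrder T Q ((GeneralisedMayer.totalDeriv T Q)^[m] f) (k + m) := by
  induction m with
  | zero => exact hf
  | succ m ih => rw [Function.iterate_succ_apply']; exact ih.totalDeriv hQ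

end HasOrder

/-! ### Smooth families of functions on the jet space -/

/-- The functions `F s`, `s ∈ [0, 1]`, on the jet space depend smoothly on `s`. -/
def SmoothFamily (T : ℝ) (Q : Set (Fin N → ℝ)) (F : ℝ → Jet (Fin N) n → ℝ) : Prop :=
  ContDiffOn ℝ ∞ (Function.uncurry F) (Icc (0 : ℝ) 1 ×ˢ jetDomain N n T Q)

namespace SmoothFamily

variable {F : ℝ → Jet (Fin N) n → ℝ}

/-- The frozen Lagrangians vary with `s` through the control. Joint smoothness in the parameter and
the jet therefore has to survive differentiation in the jet alone, or the momenta could not be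
differentiated in `s`. -/
lemma fderiv (hT : 0 < T) (hQ : IsOpen Q) (hF : SmoothFamily T Q F) :
    ContDiffOn ℝ ∞ (fun x : ℝ × Jet (Fin N) n => fderivWithin ℝ (F x.1) (jetDomain N n T Q) x.2)
      (Icc (0 : ℝ) 1 ×ˢ jetDomain N n T Q) := fun x hx =>
  ContDiffWithinAt.fderivWithin (n := ∞) (f := fun x : ℝ × Jet (Fin N) n => F x.1) (g := Prod.snd)
    (t := jetDomain N n T Q)
    (ContDiffOn.comp hF (f := fun y : (ℝ × Jet (Fin N) n) × Jet (Fin N) n => (y.1.1, y.2))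
      (by fun_prop) (fun y hy => ⟨hy.1.1, hy.2⟩) (x, x.2) ⟨hx, hx.2⟩)
    contDiffWithinAt_snd (uniqueDiffOn_jetDomain hT hQ) (by simp) hx fun _ h => h.2

lemma partialQ (hT : 0 < T) (hQ : IsOpen Q) (hF : SmoothFamily T Q F) (β : ℕ) (i : Fin N) :
    SmoothFamily T Q (fun s => partialQ T Q (F s) β i) :=
  (hF.fderiv hT hQ).clm_apply contDiffOn_const

lemma totalDeriv (hT : 0 < T) (hQ : IsOpen Q) (hF : SmoothFamily T Q F) :
    SmoothFamily T Q (fun s => totalDeriv T Q (F s)) := by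
  have h : ContDiffOn ℝ ∞ (fun x : ℝ × Jet (Fin N) n =>
      (((1 : ℝ), (0 : Fin (n + 1) → Fin N → ℝ)) + shiftL N n x.2))
      (Icc (0 : ℝ) 1 ×ˢ jetDomain N n T Q) := by fun_prop
  exact ((hF.fderiv hT hQ).clm_apply h).congr fun x _ => totalDeriv_def _ _

lemma iterate_totalDeriv (hT : 0 < T) (hQ : IsOpen Q) (hF : SmoothFamily T Q F) (m : ℕ) :
    SmoothFamily T Q (fun s => (GeneralisedMayer.totalDeriv T Q)^[m] (F s)) := by
  induction m with
  | zero => exact hF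
  | succ m ih => simp only [Function.iterate_succ_apply']; exact ih.totalDeriv hT hQ

lemma slice (hF : SmoothFamily T Q F) {s : ℝ} (hs : s ∈ Icc (0 : ℝ) 1) :
    ContDiffOn ℝ ∞ (F s) (jetDomain N n T Q) :=
  ContDiffOn.comp hF (f := fun p : Jet (Fin N) n => (s, p)) (by fun_prop) fun _ h => ⟨hs, h⟩

lemma const {f : Jet (Fin N) n → ℝ} (hf : ContDiffOn ℝ ∞ f (jetDomain N n T Q)) :
    SmoothFamily T Q (fun _ => f) :=
  hf.comp contDiffOn_snd fun _ h => h.2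

end SmoothFamily

/-! ### Algebra of total derivatives -/

section TotalDeriv

variable {f g : Jet (Fin N) n → ℝ}

lemma contDiffOn_partialQ (hT : 0 < T) (hQ : IsOpen Q)
    (hf : ContDiffOn ℝ ∞ f (jetDomain N n T Q)) (β : ℕ) (i : Fin N) :
    ContDiffOn ℝ ∞ (partialQ T Q f β i) (jetDomain N n T Q) :=
  ((SmoothFamily.const hf).partialQ hT hQ β i).slice (s := 0) ⟨le_rfl, zero_le_one⟩

lemma contDiffOn_totalDeriv (hT : 0 < T) (hQ : IsOpen Q)
    (hf : ContDiffOn ℝ ∞ f (jetDomain N n T Q)) :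
    ContDiffOn ℝ ∞ (totalDeriv T Q f) (jetDomain N n T Q) :=
  ((SmoothFamily.const hf).totalDeriv hT hQ).slice (s := 0) ⟨le_rfl, zero_le_one⟩

lemma contDiffOn_iterate_totalDeriv (hT : 0 < T) (hQ : IsOpen Q)
    (hf : ContDiffOn ℝ ∞ f (jetDomain N n T Q)) (m : ℕ) :
    ContDiffOn ℝ ∞ ((totalDeriv T Q)^[m] f) (jetDomain N n T Q) :=
  ((SmoothFamily.const hf).iterate_totalDeriv hT hQ m).slice (s := 0) ⟨le_rfl, zero_le_one⟩

lemma totalDeriv_congr (h : EqOn f g (jetDomain N n T Q)) :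
    EqOn (totalDeriv T Q f) (totalDeriv T Q g) (jetDomain N n T Q) := fun p hp => by
  rw [totalDeriv_def, totalDeriv_def, fderivWithin_congr h (h hp)]

lemma iterate_totalDeriv_congr (h : EqOn f g (jetDomain N n T Q)) (m : ℕ) :
    EqOn ((totalDeriv T Q)^[m] f) ((totalDeriv T Q)^[m] g) (jetDomain N n T Q) := by
  induction m with
  | zero => exact h
  | succ m ih => simp only [Function.iterate_succ_apply']; exact totalDeriv_congr ih

lemma fderivWithin_add_apply (hT : 0 < T) (hQ : IsOpen Q)
    (hf : ContDiffOn ℝ ∞ f (jetDomain N n T Q)) (hg : ContDiffOn ℝ ∞ g (jetDomain N n T Q))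
    {p : Jet (Fin N) n} (hp : p ∈ jetDomain N n T Q) (v : Jet (Fin N) n) :
    fderivWithin ℝ (fun p => f p + g p) (jetDomain N n T Q) p v =
      fderivWithin ℝ f (jetDomain N n T Q) p v + fderivWithin ℝ g (jetDomain N n T Q) p v := by
  rw [fderivWithin_fun_add (uniqueDiffOn_jetDomain hT hQ p hp)
    (hf.differentiableOn (by simp) p hp) (hg.differentiableOn (by simp) p hp)]
  rfl

lemma iterate_totalDeriv_add (hT : 0 < T) (hQ : IsOpen Q)
    (hf : ContDiffOn ℝ ∞ f (jetDomain N n T Q)) (hg : ContDiffOn ℝ ∞ g (jetDomain N n T Q))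
    (m : ℕ) : EqOn ((totalDeriv T Q)^[m] fun p => f p + g p)
      (fun p => (totalDeriv T Q)^[m] f p + (totalDeriv T Q)^[m] g p) (jetDomain N n T Q) := by
  induction m with
  | zero => exact fun _ _ => rfl
  | succ m ih =>
    intro p hp
    simp only [Function.iterate_succ_apply']
    rw [totalDeriv_congr ih hp, totalDeriv_def, totalDeriv_def, totalDeriv_def]
    exact fderivWithin_add_apply hT hQ (contDiffOn_iterate_totalDeriv hT hQ hf m)
      (contDiffOn_iterate_totalDeriv hT hQ hg m) hp _

lemma totalDeriv_sum_const_mul (hT : 0 < T) (hQ : IsOpen Q) {ι : Type*} (u : Finset ι)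
    (c : ι → ℝ) {f : ι → Jet (Fin N) n → ℝ}
    (hf : ∀ i ∈ u, ContDiffOn ℝ ∞ (f i) (jetDomain N n T Q)) {p : Jet (Fin N) n}
    (hp : p ∈ jetDomain N n T Q) :
    totalDeriv T Q (fun p => ∑ i ∈ u, c i * f i p) p = ∑ i ∈ u, c i * totalDeriv T Q (f i) p := by
  have hd : ∀ i ∈ u, HasFDerivWithinAt (fun p => c i * f i p)
      (c i • fderivWithin ℝ (f i) (jetDomain N n T Q) p) (jetDomain N n T Q) p := fun i hi =>
    ((hf i hi).differentiableOn (by simp) p hp).hasFDerivWithinAt.const_mul (c i)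
  rw [totalDeriv_def, (HasFDerivWithinAt.fun_sum hd).fderivWithin
    (uniqueDiffOn_jetDomain hT hQ p hp)]
  simp [totalDeriv_def]

/-- The commutator of `∂/∂q^i_(δ+1)` and `d/dt` is `∂/∂q^i_(δ)`. -/
lemma partialQ_totalDeriv (hT : 0 < T) (hQ : IsOpen Q)
    (hf : ContDiffOn ℝ ∞ f (jetDomain N n T Q)) {p : Jet (Fin N) n}
    (hp : p ∈ jetDomain N n T Q) {δ : ℕ} (hδ : δ < n) (i : Fin N) :
    partialQ T Q (totalDeriv T Q f) (δ + 1) i p =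
      totalDeriv T Q (partialQ T Q f (δ + 1) i) p + partialQ T Q f δ i p := by
  have hu := uniqueDiffOn_jetDomain (n := n) hT hQ
  set X := jetDomain N n T Q with hX
  have hd : HasFDerivWithinAt (fderivWithin ℝ f X) (fderivWithin ℝ (fderivWithin ℝ f X) X p) X p :=
    ((hf.fderivWithin (m := ∞) hu (by simp)).differentiableOn (by simp) p hp).hasFDerivWithinAt
  -- The direction `(1, 0) + shiftL p` is affine in `p`. Differentiating it gives the extra term `df
  -- ∘ shiftL`, which is the commutator because `shiftL` sends ∂/∂q_(δ+1) to ∂/∂q_(δ).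
  have hD : fderivWithin ℝ (totalDeriv T Q f) X p = _ :=
    ((hd.clm_apply (((shiftL N n).hasFDerivAt.hasFDerivWithinAt (s := X) (x := p)).const_add
      (1, 0))).congr (fun x _ => totalDeriv_def f x) (totalDeriv_def f p)).fderivWithin (hu p hp)
  have hP : fderivWithin ℝ (partialQ T Q f (δ + 1) i) X p = _ :=
    (hd.clm_apply (hasFDerivWithinAt_const (unitQ N n (δ + 1) i) p X)).fderivWithin (hu p hp)
  have hsymm : IsSymmSndFDerivWithinAt ℝ f X p := by
    refine ContDiffWithinAt.isSymmSndFDerivWithinAt (n := ∞) (hf p hp) ?_ hu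
      (jetDomain_subset_closure_interior hT hQ hp) hp
    simp only [minSmoothness_of_isRCLikeNormedField]
    exact WithTop.coe_le_coe.2 (le_top : (2 : ℕ∞) ≤ ⊤)
  rw [partialQ_def, totalDeriv_def, partialQ_def, ← hX, hD, hP]
  simp only [ContinuousLinearMap.comp_zero, zero_add, ContinuousLinearMap.flip_apply,
    add_apply, ContinuousLinearMap.comp_apply, shiftL_unitQ_succ δ hδ i]
  rw [hsymm (unitQ N n (δ + 1) i), add_comm]

end TotalDeriv

/-! ### Momenta -/

section Momentum

variable {f g : Jet (Fin N) n → ℝ}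

/-- The constraint determines δ from β and ε, and `δ ≤ r` becomes `ε < r - β`. The recursion between
consecutive momenta is visible only in this form. -/
lemma momentum_eq_sum (f : Jet (Fin N) n → ℝ) (β : ℕ) (i : Fin N) (p : Jet (Fin N) n) :
    momentum T Q r f β i p = ∑ ε ∈ Finset.range (r - β),
      (-1 : ℝ) ^ ε * ((totalDeriv T Q)^[ε] (partialQ T Q f (β + ε + 1) i)) p := by
  have h1 : ∀ δ ∈ Finset.Icc 1 r, (∑ ε ∈ Finset.range (δ + 1), if δ = β + ε + 1 then
      (-1 : ℝ) ^ ε * ((totalDeriv T Q)^[ε] (partialQ T Q f δ i)) p else 0) =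
      ∑ ε ∈ Finset.range (r + 1), if δ = β + ε + 1 then
      (-1 : ℝ) ^ ε * ((totalDeriv T Q)^[ε] (partialQ T Q f δ i)) p else 0 := by
    intro δ hδ
    rw [Finset.mem_Icc] at hδ
    refine Finset.sum_subset (Finset.range_mono (by omega)) fun ε _ hε => if_neg ?_
    rw [Finset.mem_range] at hε
    omega
  rw [momentum, Finset.sum_congr rfl h1, Finset.sum_comm]
  have h2 : ∀ ε ∈ Finset.range (r + 1), (∑ δ ∈ Finset.Icc 1 r, if δ = β + ε + 1 then
      (-1 : ℝ) ^ ε * ((totalDeriv T Q)^[ε] (partialQ T Q f δ i)) p else 0) =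
      if β + ε + 1 ≤ r then
        (-1 : ℝ) ^ ε * ((totalDeriv T Q)^[ε] (partialQ T Q f (β + ε + 1) i)) p else 0 := by
    intro ε _
    rw [Finset.sum_ite_eq']
    simp
  rw [Finset.sum_congr rfl h2]
  symm
  rw [Finset.sum_ite, Finset.sum_const_zero, add_zero]
  refine Finset.sum_congr ?_ fun _ _ => rfl
  ext ε
  simp only [Finset.mem_range, Finset.mem_filter]
  omega

lemma momentum_self (f : Jet (Fin N) n → ℝ) (i : Fin N) (p : Jet (Fin N) n) :
    momentum T Q r f r i p = 0 := by
  simp [momentum_eq_sum]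

lemma SmoothFamily.momentum {F : ℝ → Jet (Fin N) n → ℝ} (hT : 0 < T) (hQ : IsOpen Q)
    (hF : SmoothFamily T Q F) (β : ℕ) (i : Fin N) :
    SmoothFamily T Q (fun s => momentum T Q r (F s) β i) := by
  have : SmoothFamily T Q (fun s p => ∑ ε ∈ Finset.range (r - β),
      (-1 : ℝ) ^ ε * ((GeneralisedMayer.totalDeriv T Q)^[ε]
        (GeneralisedMayer.partialQ T Q (F s) (β + ε + 1) i)) p) :=
    ContDiffOn.sum fun ε _ => contDiffOn_const.mul
      ((hF.partialQ hT hQ _ i).iterate_totalDeriv hT hQ ε)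
  exact this.congr fun x _ => momentum_eq_sum _ _ _ _

/-- Each partial derivative has order `r` and at most `r - 1` total derivatives are applied. The
bound stays below `n`, so that the total derivative of a momentum is its true time derivative along
curves. -/
lemma HasOrder.momentum (hQ : IsOpen Q) (hf : HasOrder T Q f r) (β : ℕ) (i : Fin N) :
    HasOrder T Q (momentum T Q r f β i) (2 * r - 1) := by
  have : HasOrder T Q (fun p => ∑ ε ∈ Finset.range (r - β),
      (-1 : ℝ) ^ ε * ((GeneralisedMayer.totalDeriv T Q)^[ε]
        (GeneralisedMayer.partialQ T Q f (β + ε + 1) i)) p) (2 * r - 1) := by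
    refine HasOrder.sum fun ε hε => HasOrder.const_mul ?_ _
    rw [Finset.mem_range] at hε
    exact ((hf.partialQ _ i).iterate_totalDeriv hQ ε).mono (by omega)
  simpa only [← momentum_eq_sum] using this

lemma momentum_add (hT : 0 < T) (hQ : IsOpen Q)
    (hf : ContDiffOn ℝ ∞ f (jetDomain N n T Q)) (hg : ContDiffOn ℝ ∞ g (jetDomain N n T Q))
    (β : ℕ) (i : Fin N) {p : Jet (Fin N) n} (hp : p ∈ jetDomain N n T Q) :
    momentum T Q r (fun p => f p + g p) β i p =
      momentum T Q r f β i p + momentum T Q r g β i p := by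
  rw [momentum_eq_sum, momentum_eq_sum, momentum_eq_sum, ← Finset.sum_add_distrib]
  refine Finset.sum_congr rfl fun ε _ => ?_
  rw [← mul_add]
  congr 1
  refine Eq.trans ?_ (iterate_totalDeriv_add hT hQ (contDiffOn_partialQ hT hQ hf _ i)
    (contDiffOn_partialQ hT hQ hg _ i) ε hp)
  exact iterate_totalDeriv_congr (fun x hx => fderivWithin_add_apply hT hQ hf hg hx _) ε hp

lemma totalDeriv_momentum (hT : 0 < T) (hQ : IsOpen Q)
    (hf : ContDiffOn ℝ ∞ f (jetDomain N n T Q)) (β : ℕ) (i : Fin N) {p : Jet (Fin N) n}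
    (hp : p ∈ jetDomain N n T Q) :
    totalDeriv T Q (momentum T Q r f β i) p = ∑ ε ∈ Finset.range (r - β),
      (-1 : ℝ) ^ ε * ((totalDeriv T Q)^[ε + 1] (partialQ T Q f (β + ε + 1) i)) p := by
  rw [totalDeriv_congr (fun x _ => momentum_eq_sum f β i x) hp,
    totalDeriv_sum_const_mul hT hQ _ _ (fun ε _ => contDiffOn_iterate_totalDeriv hT hQ
      (contDiffOn_partialQ hT hQ hf _ i) ε) hp]
  simp only [Function.iterate_succ_apply']

/-- Ostrogradsky's recursion: the term ε = 0 of the momentum of index β is ∂f/∂q_(β+1), and its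
remaining terms are minus the total derivative of the next momentum. -/
lemma totalDeriv_momentum_succ (hT : 0 < T) (hQ : IsOpen Q)
    (hf : ContDiffOn ℝ ∞ f (jetDomain N n T Q)) {β : ℕ} (hβ : β < r) (i : Fin N)
    {p : Jet (Fin N) n} (hp : p ∈ jetDomain N n T Q) :
    totalDeriv T Q (momentum T Q r f (β + 1) i) p =
      partialQ T Q f (β + 1) i p - momentum T Q r f β i p := by
  obtain ⟨m, hm⟩ : ∃ m, r - β = m + 1 := ⟨r - β - 1, by omega⟩
  rw [totalDeriv_momentum hT hQ hf _ i hp, momentum_eq_sum, hm, Finset.sum_range_succ',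
    show r - (β + 1) = m by omega]
  simp only [pow_succ, pow_zero, Function.iterate_zero, id, mul_neg_one, neg_mul, one_mul, add_zero,
    Finset.sum_neg_distrib]
  rw [sub_add_cancel_right, neg_neg]
  refine Finset.sum_congr rfl fun ε _ => ?_
  rw [show β + 1 + ε + 1 = β + (ε + 1) + 1 by ring]

lemma totalDeriv_momentum_zero (hT : 0 < T) (hQ : IsOpen Q)
    (hf : ContDiffOn ℝ ∞ f (jetDomain N n T Q)) (i : Fin N)
    {p : Jet (Fin N) n} (hp : p ∈ jetDomain N n T Q) :
    totalDeriv T Q (momentum T Q r f 0 i) p =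
      partialQ T Q f 0 i p - eulerLagrange T Q r f i p := by
  rw [totalDeriv_momentum hT hQ hf _ i hp, eulerLagrange, sub_add_cancel_left,
    ← Finset.sum_neg_distrib, ← Finset.Ico_add_one_right_eq_Icc, Finset.sum_Ico_eq_sum_range]
  refine Finset.sum_congr (by simp) fun ε _ => ?_
  rw [show 0 + ε + 1 = 1 + ε by ring, add_comm 1 ε, pow_succ]
  ring

/-- The momenta of a total derivative `dC/dt` are the derivatives `∂C/∂q^i_(β)`. -/
lemma momentum_totalDeriv (hT : 0 < T) (hQ : IsOpen Q) (hrn : r ≤ n)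
    (hf : ContDiffOn ℝ ∞ f (jetDomain N n T Q)) (hk : HasOrder T Q f k) (hkr : k + 1 ≤ r)
    {β : ℕ} (hβ : β ≤ r) (i : Fin N) {p : Jet (Fin N) n} (hp : p ∈ jetDomain N n T Q) :
    momentum T Q r (totalDeriv T Q f) β i p = partialQ T Q f β i p := by
  induction hβ using Nat.decreasingInduction generalizing p with
  -- Descending induction from index `r`, where the momentum is an empty sum and ∂f/∂q_(r) vanishes
  -- because `k < r`. Each step down is the Ostrogradsky recursion combined with the commutator of
  -- ∂/∂q_(β+1) and d/dt.
  | self => rw [momentum_self, hk.partialQ_eq_zero hQ hp (by omega)]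
  | of_succ β hβ ih =>
    have h1 := totalDeriv_momentum_succ hT hQ (contDiffOn_totalDeriv hT hQ hf) hβ i hp
    rw [totalDeriv_congr (fun x hx => ih hx) hp,
      partialQ_totalDeriv hT hQ hf hp (by omega)] at h1
    linarith

end Momentum

end JetSpace

/-! ## Jets of families of curves -/

section Families

variable {ι : Type} [Fintype ι] {N n r k : ℕ} {T : ℝ} {Q : Set (Fin N → ℝ)} {t s : ℝ}

lemma coord_jet {β : ℕ} (hβ : β ≤ n) (c : ℝ → ι → ℝ) (t : ℝ) (ℓ : ι) :
    coord (jet n T c t) β ℓ = iteratedDerivWithin β c (Icc 0 T) t ℓ := by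
  simp [coord, jet, Nat.lt_succ_of_le hβ]

lemma iteratedDerivWithin_apply_pi (hT : 0 < T) {c : ℝ → ι → ℝ}
    (hc : ∀ ℓ, ContDiffOn ℝ ∞ (fun t => c t ℓ) (Icc 0 T)) (β : ℕ) (ht : t ∈ Icc 0 T) (ℓ : ι) :
    iteratedDerivWithin β c (Icc 0 T) t ℓ =
      iteratedDerivWithin β (fun t => c t ℓ) (Icc 0 T) t := by
  induction β generalizing t with
  | zero => simp
  | succ β ih =>
    have hd : DifferentiableWithinAt ℝ (iteratedDerivWithin β c (Icc 0 T)) (Icc 0 T) t :=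
      (contDiffOn_pi.2 hc).differentiableOn_iteratedDerivWithin
        (WithTop.coe_lt_coe.2 (ENat.natCast_lt_top β)) (uniqueDiffOn_Icc hT) t ht
    rw [iteratedDerivWithin_succ, iteratedDerivWithin_succ,
      (hasDerivWithinAt_pi.1 hd.hasDerivWithinAt ℓ).derivWithin (uniqueDiffOn_Icc hT t ht) |>.symm]
    exact derivWithin_congr (fun x hx => ih hx) (ih ht)

/-- The derivative of the jets of a family of curves with respect to the parameter. -/
lemma hasDerivWithinAt_jet (hT : 0 < T) {c : ℝ → ℝ → ι → ℝ}
    (hc : ∀ s ∈ Icc (0 : ℝ) 1, ∀ ℓ, ContDiffOn ℝ ∞ (fun t => c t s ℓ) (Icc 0 T))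
    (ht : t ∈ Icc 0 T) (hs : s ∈ Icc (0 : ℝ) 1)
    (hd : ∀ (β : ℕ) (ℓ : ι), DifferentiableWithinAt ℝ
      (fun s => dtn T β (fun t s => c t s ℓ) t s) (Icc 0 1) s) :
    HasDerivWithinAt (fun s => jet n T (fun t => c t s) t)
      ((0, fun β ℓ => ds (dtn T β fun t s => c t s ℓ) t s) : Jet ι n) (Icc 0 1) s := by
  refine (hasDerivWithinAt_const s _ t).prodMk (hasDerivWithinAt_pi.2 fun β =>
    hasDerivWithinAt_pi.2 fun ℓ => ?_)
  exact (hd β ℓ).hasDerivWithinAt.congr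
    (fun s' hs' => iteratedDerivWithin_apply_pi hT (hc s' hs') β ht ℓ)
    (iteratedDerivWithin_apply_pi hT (hc s hs) β ht ℓ)

lemma SmoothOnRect.apply {q : ℝ → ℝ → ι → ℝ} (hq : SmoothOnRect T q) (ℓ : ι) :
    SmoothOnRect T (fun t s => q t s ℓ) := contDiffOn_pi.1 hq ℓ

lemma dtn_apply (hT : 0 < T) {q : ℝ → ℝ → ι → ℝ} (hq : SmoothOnRect T q) (β : ℕ)
    (ht : t ∈ Icc 0 T) (hs : s ∈ Icc (0 : ℝ) 1) (ℓ : ι) :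
    dtn T β q t s ℓ = dtn T β (fun t s => q t s ℓ) t s :=
  iteratedDerivWithin_apply_pi hT (fun ℓ => (hq.apply ℓ).fst hs) β ht ℓ

lemma SmoothOnRect.jet (hT : 0 < T) {q : ℝ → ℝ → ι → ℝ} (hq : SmoothOnRect T q) :
    SmoothOnRect T (fun t s => jet n T (fun t => q t s) t) :=
  contDiffOn_fst.prodMk (contDiffOn_pi.2 fun β => hq.dtn hT β)

lemma hasDerivWithinAt_jet_of_smooth (hT : 0 < T) {q : ℝ → ℝ → ι → ℝ} (hq : SmoothOnRect T q)
    (ht : t ∈ Icc 0 T) (hs : s ∈ Icc (0 : ℝ) 1) :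
    HasDerivWithinAt (fun s => jet n T (fun t => q t s) t)
      ((0, fun β ℓ => ds (dtn T β fun t s => q t s ℓ) t s) : Jet ι n) (Icc 0 1) s :=
  hasDerivWithinAt_jet hT (fun _ hs' ℓ => (hq.apply ℓ).fst hs') ht hs fun β ℓ =>
    (((hq.apply ℓ).dtn hT β).hasDerivWithinAt_snd ht hs).differentiableWithinAt

lemma jet_mem_jetDomain {q : ℝ → Fin N → ℝ} (ht : t ∈ Icc 0 T) (hq : q t ∈ Q) :
    jet n T q t ∈ jetDomain N n T Q := ⟨ht, by simpa [jet] using hq⟩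

/-- Total derivatives are derivatives along the jets of curves. -/
lemma dt_comp_jet (hT : 0 < T) (hQ : IsOpen Q) {q : ℝ → ℝ → Fin N → ℝ} (hq : SmoothOnRect T q)
    (hqQ : ∀ t ∈ Icc 0 T, ∀ s ∈ Icc (0 : ℝ) 1, q t s ∈ Q) {F : ℝ → Jet (Fin N) n → ℝ}
    (hF : SmoothFamily T Q F) (hk : HasOrder T Q (F s) k) (hkn : k < n)
    (ht : t ∈ Icc 0 T) (hs : s ∈ Icc (0 : ℝ) 1) :
    HasDerivWithinAt (fun t => F s (jet n T (fun t => q t s) t))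
      (totalDeriv T Q (F s) (jet n T (fun t => q t s) t)) (Icc 0 T) t := by
  have hp : jet n T (fun t => q t s) t ∈ jetDomain N n T Q := jet_mem_jetDomain ht (hqQ t ht s hs)
  have hJ : HasDerivWithinAt (fun t => jet n T (fun t => q t s) t)
      ((1, fun β => dtn T (β + 1) q t s) : Jet (Fin N) n) (Icc 0 T) t := by
    refine (hasDerivWithinAt_id t _).prodMk (hasDerivWithinAt_pi.2 fun β => ?_)
    rw [dtn_succ]
    exact (hq.dtn hT β).hasDerivWithinAt_fst hT ht hs
  have h := (((hF.slice hs).differentiableOn (by simp) _ hp).hasFDerivWithinAt).comp_hasDerivWithinAt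
    t hJ fun t' ht' => jet_mem_jetDomain ht' (hqQ t' ht' s hs)
  convert! h using 1
  -- The velocity of the prolonged curve and the vector in `totalDeriv` differ only in slot `n`,
  -- where the latter is truncated to `0`. A function of order `k < n` does not see that slot.
  rw [totalDeriv, ← sub_eq_zero, ← map_sub]
  refine hk.fderivWithin_apply_eq_zero hQ hp (by simp) fun β hβ => ?_
  ext j
  simp [coord_jet (show (β : ℕ) + 1 ≤ n by omega), dtn]

lemma SmoothFamily.comp_jet (hT : 0 < T) {q : ℝ → ℝ → Fin N → ℝ} (hq : SmoothOnRect T q)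
    (hqQ : ∀ t ∈ Icc 0 T, ∀ s ∈ Icc (0 : ℝ) 1, q t s ∈ Q) {F : ℝ → Jet (Fin N) n → ℝ}
    (hF : SmoothFamily T Q F) :
    SmoothOnRect T (fun t s => F s (GeneralisedMayer.jet n T (fun t => q t s) t)) :=
  ContDiffOn.comp hF (f := fun x : ℝ × ℝ =>
    (x.2, GeneralisedMayer.jet n T (fun t => q t x.2) x.1))
    (contDiffOn_snd.prodMk (hq.jet hT)) fun x hx =>
      ⟨hx.2, jet_mem_jetDomain hx.1 (hqQ x.1 hx.1 x.2 hx.2)⟩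

lemma vertical_eq_sum (v : Fin (n + 1) → Fin N → ℝ) :
    ((0, v) : Jet (Fin N) n) = ∑ i, ∑ β : Fin (n + 1), v β i • unitQ N n β i := by
  ext β j
  · simp [Prod.fst_sum, unitQ]
  · simp only [Prod.snd_sum, Finset.sum_apply, Prod.smul_snd, unitQ, Pi.smul_apply, smul_eq_mul,
      mul_ite, mul_one, mul_zero]
    rw [Finset.sum_eq_single j, Finset.sum_eq_single β]
    · simp
    · intro β' _ h
      rw [if_neg]
      exact fun h' => h (Fin.ext h'.1.symm)
    · simp
    · intro i _ h
      exact Finset.sum_eq_zero fun β' _ => if_neg fun h' => h h'.2.symm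
    · simp

/-- The derivative of a function of order `r` along a vertical vector. -/
lemma HasOrder.fderivWithin_vertical (hQ : IsOpen Q) {f : Jet (Fin N) n → ℝ}
    (hf : HasOrder T Q f r) (hrn : r ≤ n) {p : Jet (Fin N) n} (hp : p ∈ jetDomain N n T Q)
    (v : ℕ → Fin N → ℝ) :
    fderivWithin ℝ f (jetDomain N n T Q) p (0, fun β => v β) =
      ∑ i, ∑ β ∈ Finset.range (r + 1), GeneralisedMayer.partialQ T Q f β i p * v β i := by
  rw [vertical_eq_sum, map_sum]
  refine Finset.sum_congr rfl fun i _ => ?_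
  rw [map_sum]
  simp only [map_smul, smul_eq_mul, ← partialQ_def]
  rw [Fin.sum_univ_eq_sum_range (fun β => v β i * GeneralisedMayer.partialQ T Q f β i p)]
  symm
  rw [Finset.sum_subset (Finset.range_mono (Nat.succ_le_succ hrn))]
  · exact Finset.sum_congr rfl fun _ _ => mul_comm _ _
  · intro β _ hβ
    rw [Finset.mem_range] at hβ
    rw [hf.partialQ_eq_zero hQ hp (by omega), zero_mul]

/-- The pairing of the momenta of the Lagrangians `F s` with the variation of the curves. -/
def momentumPairing (n r : ℕ) (T : ℝ) (Q : Set (Fin N → ℝ)) (F : ℝ → Jet (Fin N) n → ℝ)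
    (q : ℝ → ℝ → Fin N → ℝ) (t s : ℝ) : ℝ :=
  ∑ i, ∑ β ∈ Finset.range (r + 1), momentum T Q r (F s) β i (jet n T (fun t => q t s) t) *
    ds (dtn T β fun t s => q t s i) t s

lemma smoothOnRect_momentumPairing (hT : 0 < T) (hQ : IsOpen Q) {q : ℝ → ℝ → Fin N → ℝ}
    (hq : SmoothOnRect T q) (hqQ : ∀ t ∈ Icc 0 T, ∀ s ∈ Icc (0 : ℝ) 1, q t s ∈ Q)
    {F : ℝ → Jet (Fin N) n → ℝ} (hF : SmoothFamily T Q F) :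
    SmoothOnRect T (momentumPairing n r T Q F q) :=
  SmoothOnRect.sum fun i _ => SmoothOnRect.sum fun β _ =>
    ((hF.momentum hT hQ β i).comp_jet hT hq hqQ).mul (((hq.apply i).dtn hT β).ds hT)

/-- The first variation formula for families of solutions of Euler-Lagrange equations. -/
lemma hasDerivWithinAt_momentumPairing (hT : 0 < T) (hQ : IsOpen Q) (hr : 1 ≤ r) (hrn : 2 * r ≤ n)
    {q : ℝ → ℝ → Fin N → ℝ} (hq : SmoothOnRect T q)
    (hqQ : ∀ t ∈ Icc 0 T, ∀ s ∈ Icc (0 : ℝ) 1, q t s ∈ Q)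
    {F : ℝ → Jet (Fin N) n → ℝ} (hF : SmoothFamily T Q F) (hFr : HasOrder T Q (F s) r)
    (ht : t ∈ Icc 0 T) (hs : s ∈ Icc (0 : ℝ) 1)
    (hEL : ∀ i, eulerLagrange T Q r (F s) i (jet n T (fun t => q t s) t) = 0) :
    HasDerivWithinAt (fun t => momentumPairing n r T Q F q t s)
      (fderivWithin ℝ (F s) (jetDomain N n T Q) (jet n T (fun t => q t s) t)
        (0, fun β i => ds (dtn T β fun t s => q t s i) t s)) (Icc 0 T) t := by
  have hp : jet n T (fun t => q t s) t ∈ jetDomain N n T Q := jet_mem_jetDomain ht (hqQ t ht s hs)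
  rw [hFr.fderivWithin_vertical hQ (by omega) hp fun β i => ds (dtn T β fun t s => q t s i) t s]
  refine HasDerivWithinAt.fun_sum fun i _ => ?_
  have hd := HasDerivWithinAt.fun_sum (u := Finset.range (r + 1)) fun β _ =>
    (dt_comp_jet hT hQ hq hqQ (hF.momentum (r := r) hT hQ β i) (hFr.momentum hQ β i)
      (by omega) ht hs).mul
    ((((hq.apply i).dtn hT β).ds hT).hasDerivWithinAt_fst hT ht hs)
  refine hd.congr_deriv ?_
  -- By the recursion the sum telescopes: since ∂/∂t δq_(m) = δq_(m+1), the partial sum up to `m`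
  -- leaves the single remainder π^m δq_(m+1). The Euler–Lagrange equation starts the telescope at
  -- `m = 0`, and the zero momentum of index `r` closes it.
  have hsum : ∀ m ≤ r, ∑ β ∈ Finset.range (m + 1),
      (totalDeriv T Q (momentum T Q r (F s) β i) (jet n T (fun t => q t s) t) *
          ds (dtn T β fun t s => q t s i) t s +
        momentum T Q r (F s) β i (jet n T (fun t => q t s) t) *
          dt T (ds (dtn T β fun t s => q t s i)) t s) =
      ∑ β ∈ Finset.range (m + 1), partialQ T Q (F s) β i (jet n T (fun t => q t s) t) *
          ds (dtn T β fun t s => q t s i) t s +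
        momentum T Q r (F s) m i (jet n T (fun t => q t s) t) *
          ds (dtn T (m + 1) fun t s => q t s i) t s := by
    intro m
    induction m with
    | zero =>
      intro _
      simp only [zero_add, Finset.sum_range_one]
      rw [totalDeriv_momentum_zero hT hQ (hF.slice hs) i hp, hEL i,
        ← (hq.apply i).ds_dtn_succ hT 0 ht hs, sub_zero]
    | succ m ih =>
      intro hm
      rw [Finset.sum_range_succ, ih (by omega), Finset.sum_range_succ _ (m + 1),
        totalDeriv_momentum_succ hT hQ (hF.slice hs) (by omega) i hp,
        ← (hq.apply i).ds_dtn_succ hT (m + 1) ht hs]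
      ring
  rw [hsum r le_rfl, momentum_self, zero_mul, add_zero]

end Families

/-! ## The auxiliary functions -/

section Auxiliary

variable {T : ℝ} {t s : ℝ}

lemma iteratedDerivWithin_succ_of_hasDerivAt (hT : 0 < T) {f f' : ℝ → ℝ}
    (h : ∀ t, HasDerivAt f (f' t) t) (m : ℕ) (ht : t ∈ Icc 0 T) :
    iteratedDerivWithin (m + 1) f (Icc 0 T) t = iteratedDerivWithin m f' (Icc 0 T) t := by
  rw [iteratedDerivWithin_succ']
  exact iteratedDerivWithin_congr
    (fun x hx => (h x).hasDerivWithinAt.derivWithin (uniqueDiffOn_Icc hT x hx)) ht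

/-- The function is a cosh t + b sinh t, so differentiation exchanges the two initial data. -/
lemma hasDerivAt_expFun (a b t : ℝ) : HasDerivAt (expFun a b) (expFun b a t) t := by
  have h1 := ((Real.hasDerivAt_exp t).const_mul ((a + b) / 2))
  have h2 := ((Real.hasDerivAt_exp (-t)).comp t (hasDerivAt_neg t)).const_mul ((a - b) / 2)
  refine (h1.add h2).congr_deriv ?_
  simp only [expFun]
  ring

lemma expFun_zero (a b : ℝ) : expFun a b 0 = a := by
  simp only [expFun, neg_zero, Real.exp_zero]
  ring

lemma smoothOnRect_expFun {a b : ℝ → ℝ} (ha : ContDiffOn ℝ ∞ a (Icc 0 1))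
    (hb : ContDiffOn ℝ ∞ b (Icc 0 1)) : SmoothOnRect T (fun t s => expFun (a s) (b s) t) := by
  have ha' := SmoothOnRect.of_snd (T := T) ha
  have hb' := SmoothOnRect.of_snd (T := T) hb
  have h2 := SmoothOnRect.const (T := T) (2⁻¹ : ℝ)
  simp only [expFun, div_eq_mul_inv]
  exact (((ha'.add hb').mul h2).mul (.of_fst Real.contDiff_exp)).add
    (((ha'.sub hb').mul h2).mul (.of_fst (Real.contDiff_exp.comp contDiff_neg)))

/-- The function `c₀ e^{kt} + c₁ e^{-kt} + c₂ cos(kt) + c₃ sin(kt)`. -/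
def expTrig (k : ℝ) (c : Fin 4 → ℝ) (t : ℝ) : ℝ :=
  c 0 * Real.exp (k * t) + c 1 * Real.exp (-(k * t)) + c 2 * Real.cos (k * t)
    + c 3 * Real.sin (k * t)

/-- Differentiation acts linearly on the coefficients, and its fourth power is multiplication by `k
^ 4`; all derivatives needed below are read off from this action. -/
lemma hasDerivAt_expTrig (k : ℝ) (c : Fin 4 → ℝ) (t : ℝ) :
    HasDerivAt (expTrig k c) (expTrig k ![k * c 0, -k * c 1, k * c 3, -k * c 2] t) t := by
  have h := (hasDerivAt_id t).const_mul k
  have h1 := ((Real.hasDerivAt_exp (k * t)).comp t h).const_mul (c 0)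
  have h2 := ((Real.hasDerivAt_exp (-(k * t))).comp t h.neg).const_mul (c 1)
  have h3 := ((Real.hasDerivAt_cos (k * t)).comp t h).const_mul (c 2)
  have h4 := ((Real.hasDerivAt_sin (k * t)).comp t h).const_mul (c 3)
  refine (((h1.add h2).add h3).add h4).congr_deriv ?_
  simp [expTrig]
  ring

/-- The homogeneous boundary problem has only the zero solution. Without this, the matrix inverse
that defines the coefficients would be a default value and no boundary condition would hold. -/
lemma det_boundaryMatrix_ne_zero (hT : 0 < T) : (boundaryMatrix T).det ≠ 0 := by
  intro h
  obtain ⟨v, hv, hMv⟩ := Matrix.exists_mulVec_eq_zero_iff.2 h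
  set k := Real.pi / (2 * T) with hk
  have hk0 : k ≠ 0 := by positivity
  set e := Real.exp (Real.pi / 2) with he
  set e' := Real.exp (-(Real.pi / 2)) with he'
  have he0 : 0 < e := Real.exp_pos _
  have he1 : e' < 1 := Real.exp_lt_one_iff.2 (by linarith [Real.pi_pos])
  have e0 := congrFun hMv 0
  have e1 := congrFun hMv 1
  have e2 := congrFun hMv 2
  have e3 := congrFun hMv 3
  simp only [boundaryMatrix, Matrix.mulVec, dotProduct, Fin.sum_univ_four, ← hk, ← he, ← he',
    Matrix.of_apply, Matrix.cons_val, Pi.zero_apply] at e0 e1 e2 e3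
  have f1 : v 0 - v 1 + v 3 = 0 := mul_left_cancel₀ hk0 (by linear_combination e1)
  have f2 : e * v 0 - e' * v 1 - v 2 = 0 := mul_left_cancel₀ hk0 (by linear_combination e2)
  have f3 : e * v 0 + e' * v 1 - v 3 = 0 :=
    mul_left_cancel₀ (pow_ne_zero 2 hk0) (by linear_combination e3)
  have g1 : v 1 = 0 := by
    -- This combination of the four equations eliminates `v 0`, `v 2` and `v 3`; the factor `1 - e'`
    -- is nonzero as `e' = exp(-π/2) < 1`.
    have : (1 - e') * v 1 = (1 - e') * 0 := by linear_combination (e0 + f2 - f1 - f3) / 2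
    exact mul_left_cancel₀ (by linarith) this
  have g0 : v 0 = 0 := by
    have : (e + 1) * v 0 = (e + 1) * 0 := by linear_combination (1 - e') * g1 + f1 + f3
    exact mul_left_cancel₀ (by linarith) this
  refine hv (funext fun j => ?_)
  fin_cases j
  · exact g0
  · exact g1
  · simpa [g0, g1] using e0
  · simpa [g0, g1] using f1

/-- The coefficients of `expTrigFun`. -/
def boundaryCoeff (T a b : ℝ) : Fin 4 → ℝ := (boundaryMatrix T)⁻¹ *ᵥ ![0, 0, a, b]

lemma expTrigFun_eq (a b : ℝ) :
    expTrigFun T a b = expTrig (Real.pi / (2 * T)) (boundaryCoeff T a b) := rfl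

lemma boundaryMatrix_mulVec (hT : 0 < T) (a b : ℝ) :
    boundaryMatrix T *ᵥ boundaryCoeff T a b = ![0, 0, a, b] := by
  rw [boundaryCoeff, Matrix.mulVec_mulVec, Matrix.mul_nonsing_inv _
    (isUnit_iff_ne_zero.2 (det_boundaryMatrix_ne_zero hT)), Matrix.one_mulVec]

lemma smoothOnRect_expTrigFun {a b : ℝ → ℝ} (ha : ContDiffOn ℝ ∞ a (Icc 0 1))
    (hb : ContDiffOn ℝ ∞ b (Icc 0 1)) :
    SmoothOnRect T (fun t s => expTrigFun T (a s) (b s) t) := by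
  have ha' := SmoothOnRect.of_snd (T := T) ha
  have hb' := SmoothOnRect.of_snd (T := T) hb
  have hc : ∀ j, SmoothOnRect T (fun _ s => boundaryCoeff T (a s) (b s) j) := fun j => by
    simp only [boundaryCoeff, Matrix.mulVec, dotProduct, Fin.sum_univ_four, Matrix.cons_val,
      mul_zero, zero_add]
    exact ((SmoothOnRect.const _).mul ha').add ((SmoothOnRect.const _).mul hb')
  simp only [expTrigFun_eq, expTrig]
  refine ((((hc 0).mul (.of_fst ?_)).add ((hc 1).mul (.of_fst ?_))).add
    ((hc 2).mul (.of_fst ?_))).add ((hc 3).mul (.of_fst ?_)) <;> fun_prop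

lemma iteratedDerivWithin_one_expTrig (hT : 0 < T) (k : ℝ) (c : Fin 4 → ℝ) (ht : t ∈ Icc 0 T) :
    iteratedDerivWithin 1 (expTrig k c) (Icc 0 T) t =
      expTrig k ![k * c 0, -k * c 1, k * c 3, -k * c 2] t := by
  rw [iteratedDerivWithin_succ_of_hasDerivAt hT (hasDerivAt_expTrig _ _) 0 ht,
    iteratedDerivWithin_zero]

lemma iteratedDerivWithin_two_expTrig (hT : 0 < T) (k : ℝ) (c : Fin 4 → ℝ) (ht : t ∈ Icc 0 T) :
    iteratedDerivWithin 2 (expTrig k c) (Icc 0 T) t =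
      expTrig k ![k ^ 2 * c 0, k ^ 2 * c 1, -k ^ 2 * c 2, -k ^ 2 * c 3] t := by
  rw [iteratedDerivWithin_succ_of_hasDerivAt hT (hasDerivAt_expTrig _ _) 1 ht,
    iteratedDerivWithin_one_expTrig hT _ _ ht]
  simp only [expTrig, Matrix.cons_val]
  ring

lemma expTrigFun_zero (hT : 0 < T) (a b : ℝ) : expTrigFun T a b 0 = 0 := by
  have h := congrFun (boundaryMatrix_mulVec hT a b) 0
  simp only [boundaryMatrix, Matrix.mulVec, dotProduct, Fin.sum_univ_four,
    Matrix.of_apply, Matrix.cons_val] at h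
  rw [expTrigFun_eq]
  simp only [expTrig, mul_zero, neg_zero, Real.exp_zero, Real.cos_zero, Real.sin_zero]
  linear_combination h

lemma iteratedDerivWithin_one_expTrigFun_zero (hT : 0 < T) (a b : ℝ) :
    iteratedDerivWithin 1 (expTrigFun T a b) (Icc 0 T) 0 = 0 := by
  have h := congrFun (boundaryMatrix_mulVec hT a b) 1
  simp only [boundaryMatrix, Matrix.mulVec, dotProduct, Fin.sum_univ_four,
    Matrix.of_apply, Matrix.cons_val] at h
  rw [expTrigFun_eq, iteratedDerivWithin_one_expTrig hT _ _ (left_mem_Icc.2 hT.le)]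
  simp only [expTrig, mul_zero, neg_zero, Real.exp_zero, Real.cos_zero, Real.sin_zero,
    Matrix.cons_val]
  linear_combination h

lemma pi_div_mul_self (hT : 0 < T) : Real.pi / (2 * T) * T = Real.pi / 2 := by
  field_simp

lemma iteratedDerivWithin_one_expTrigFun_right (hT : 0 < T) (a b : ℝ) :
    iteratedDerivWithin 1 (expTrigFun T a b) (Icc 0 T) T = a := by
  have h := congrFun (boundaryMatrix_mulVec hT a b) 2
  simp only [boundaryMatrix, Matrix.mulVec, dotProduct, Fin.sum_univ_four,
    Matrix.of_apply, Matrix.cons_val] at h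
  rw [expTrigFun_eq, iteratedDerivWithin_one_expTrig hT _ _ (right_mem_Icc.2 hT.le)]
  simp only [expTrig, pi_div_mul_self hT, Real.cos_pi_div_two, Real.sin_pi_div_two,
    Matrix.cons_val]
  linear_combination h

lemma iteratedDerivWithin_two_expTrigFun_right (hT : 0 < T) (a b : ℝ) :
    iteratedDerivWithin 2 (expTrigFun T a b) (Icc 0 T) T = b := by
  have h := congrFun (boundaryMatrix_mulVec hT a b) 3
  simp only [boundaryMatrix, Matrix.mulVec, dotProduct, Fin.sum_univ_four,
    Matrix.of_apply, Matrix.cons_val] at h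
  rw [expTrigFun_eq, iteratedDerivWithin_two_expTrig hT _ _ (right_mem_Icc.2 hT.le)]
  simp only [expTrig, pi_div_mul_self hT, Real.cos_pi_div_two, Real.sin_pi_div_two,
    Matrix.cons_val]
  linear_combination h

lemma iteratedDerivWithin_four_expTrigFun (hT : 0 < T) (a b : ℝ) (ht : t ∈ Icc 0 T) :
    iteratedDerivWithin 4 (expTrigFun T a b) (Icc 0 T) t =
      Real.pi ^ 4 / (16 * T ^ 4) * expTrigFun T a b t := by
  rw [expTrigFun_eq, iteratedDerivWithin_succ_of_hasDerivAt hT (hasDerivAt_expTrig _ _) 3 ht,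
    iteratedDerivWithin_succ_of_hasDerivAt hT (hasDerivAt_expTrig _ _) 2 ht,
    iteratedDerivWithin_succ_of_hasDerivAt hT (hasDerivAt_expTrig _ _) 1 ht,
    iteratedDerivWithin_one_expTrig hT _ _ ht]
  have hk : Real.pi ^ 4 / (16 * T ^ 4) = (Real.pi / (2 * T)) ^ 4 := by
    field_simp
    norm_num
  rw [hk]
  simp only [expTrig, Matrix.cons_val]
  ring

lemma iteratedDerivWithin_one_expFun (hT : 0 < T) (a b : ℝ) (ht : t ∈ Icc 0 T) :
    iteratedDerivWithin 1 (expFun a b) (Icc 0 T) t = expFun b a t := by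
  rw [iteratedDerivWithin_succ_of_hasDerivAt hT (hasDerivAt_expFun _ _) 0 ht,
    iteratedDerivWithin_zero]

lemma iteratedDerivWithin_two_expFun (hT : 0 < T) (a b : ℝ) (ht : t ∈ Icc 0 T) :
    iteratedDerivWithin 2 (expFun a b) (Icc 0 T) t = expFun a b t := by
  rw [iteratedDerivWithin_succ_of_hasDerivAt hT (hasDerivAt_expFun _ _) 1 ht,
    iteratedDerivWithin_one_expFun hT b a ht]

/-! ### Boundary terms of the auxiliary Lagrangians -/

namespace SmoothOnRect

variable {f : ℝ → ℝ → ℝ}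

/-- The boundary term of a Lagrangian `(f_(1)² + f²) / 2` along its extremals. -/
lemma hasDerivWithinAt_pairing_one (hT : 0 < T) (hf : SmoothOnRect T f) (ht : t ∈ Icc 0 T)
    (hs : s ∈ Icc (0 : ℝ) 1) (h2 : GeneralisedMayer.dtn T 2 f t s = f t s) :
    HasDerivWithinAt (fun t => GeneralisedMayer.dtn T 1 f t s * GeneralisedMayer.ds f t s)
      (GeneralisedMayer.dtn T 1 f t s *
          GeneralisedMayer.ds (GeneralisedMayer.dtn T 1 f) t s
        + f t s * GeneralisedMayer.ds f t s) (Icc 0 T) t := by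
  have h := ((hf.dtn hT 1).hasDerivWithinAt_fst hT ht hs).mul
    ((hf.ds hT).hasDerivWithinAt_fst hT ht hs)
  refine h.congr_deriv ?_
  have e := hf.ds_dtn_succ hT 0 ht hs
  rw [dtn_zero] at e
  rw [← dtn_succ, h2, ← e]
  ring

/-- The boundary term of a Lagrangian `(-f_(2)² + c f²) / 2` along its extremals. -/
lemma hasDerivWithinAt_pairing_two (hT : 0 < T) (hf : SmoothOnRect T f) (ht : t ∈ Icc 0 T)
    (hs : s ∈ Icc (0 : ℝ) 1) {c : ℝ} (h4 : GeneralisedMayer.dtn T 4 f t s = c * f t s) :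
    HasDerivWithinAt (fun t => GeneralisedMayer.dtn T 3 f t s * GeneralisedMayer.ds f t s -
        GeneralisedMayer.dtn T 2 f t s * GeneralisedMayer.ds (GeneralisedMayer.dtn T 1 f) t s)
      (c * f t s * GeneralisedMayer.ds f t s - GeneralisedMayer.dtn T 2 f t s *
          GeneralisedMayer.ds (GeneralisedMayer.dtn T 2 f) t s) (Icc 0 T) t := by
  have h := (((hf.dtn hT 3).hasDerivWithinAt_fst hT ht hs).mul
    ((hf.ds hT).hasDerivWithinAt_fst hT ht hs)).sub
    (((hf.dtn hT 2).hasDerivWithinAt_fst hT ht hs).mul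
    (((hf.dtn hT 1).ds hT).hasDerivWithinAt_fst hT ht hs))
  refine h.congr_deriv ?_
  have e := hf.ds_dtn_succ hT 0 ht hs
  rw [dtn_zero] at e
  rw [← dtn_succ, ← dtn_succ, h4, ← e, ← hf.ds_dtn_succ hT 1 ht hs]
  ring

end SmoothOnRect

end Auxiliary

namespace DefiningTriple

/-! ## Smoothness of the controlled variations -/

variable {N M n r : ℕ} {T : ℝ} {D : DefiningTriple N M n r T} {U : ℝ → ControlPair N M r}
  {t s : ℝ}

namespace IsSmoothCurve

lemma isSolution (hU : D.IsSmoothCurve U) (hs : s ∈ Icc (0 : ℝ) 1) :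
    IsSolution T D.Q D.L (U s) (D.controlledCurve (U s)) := by
  obtain ⟨γ, hγ, -⟩ := D.existsUnique_solution _ (hU.mem s hs)
  exact Classical.epsilon_spec ⟨γ, hγ⟩

lemma smoothOnRect_variation (hU : D.IsSmoothCurve U) : SmoothOnRect T (D.variation U) :=
  hU.smooth_variation

lemma smoothOnRect_control (hU : D.IsSmoothCurve U) :
    SmoothOnRect T (fun t s => (U s).control t) :=
  hU.smooth_control

lemma variation_mem (hU : D.IsSmoothCurve U) :
    ∀ t ∈ Icc 0 T, ∀ s ∈ Icc (0 : ℝ) 1, D.variation U t s ∈ D.Q :=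
  fun t ht _ hs => (hU.isSolution hs).mem t ht

lemma control_mem (hU : D.IsSmoothCurve U) (ht : t ∈ Icc 0 T) (hs : s ∈ Icc (0 : ℝ) 1) :
    (U s).control t ∈ D.K := D.control_mem _ (hU.mem s hs) t ht

lemma jet_mem (hU : D.IsSmoothCurve U) (ht : t ∈ Icc 0 T) (hs : s ∈ Icc (0 : ℝ) 1) :
    jet n T (D.controlledCurve (U s)) t ∈ jetDomain N n T D.Q :=
  jet_mem_jetDomain ht (hU.variation_mem t ht s hs)

lemma smoothFamily_frozen (hU : D.IsSmoothCurve U) :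
    SmoothFamily T D.Q (fun s => frozen D.L (U s).control) := by
  refine ContDiffOn.comp D.smooth_L
    (f := fun x : ℝ × Jet (Fin N) n => (x.2, (U x.1).control x.2.1)) ?_
    fun x hx => ⟨hx.2, hU.control_mem hx.2.1 hx.1⟩
  refine contDiffOn_snd.prodMk (ContDiffOn.comp hU.smooth_control
    (f := fun x : ℝ × Jet (Fin N) n => (x.2.1, x.1)) ?_ fun x hx => ⟨hx.2.1, hx.1⟩)
  fun_prop

lemma hasOrder_frozen (hU : D.IsSmoothCurve U) (hs : s ∈ Icc (0 : ℝ) 1) :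
    HasOrder T D.Q (frozen D.L (U s).control) r := fun p hp p' hp' h1 h2 => by
  simp only [frozen, ← h1]
  exact D.order_L _ (hU.control_mem hp.1 hs) p hp p' hp' h1 h2

end IsSmoothCurve

lemma contDiffOn_dC (hT : 0 < T) (D : DefiningTriple N M n r T) :
    ContDiffOn ℝ ∞ D.dC (jetDomain N n T D.Q) :=
  contDiffOn_totalDeriv hT D.isOpen_Q D.smooth_C

lemma IsSmoothCurve.smoothFamily_frozen_add (hT : 0 < T) (hU : D.IsSmoothCurve U) :
    SmoothFamily T D.Q (fun s p => frozen D.L (U s).control p + D.dC p) :=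
  ContDiffOn.add hU.smoothFamily_frozen (SmoothFamily.const (D.contDiffOn_dC hT))

/-! ### The associated curves -/

/-- The family of the curves `(q^i, h^i_β, h'^i_β, h''^i_β)`. -/
def tildeFamily (D : DefiningTriple N M n r T) (U : ℝ → ControlPair N M r) (ℓ : TildeIdx N r)
    (t s : ℝ) : ℝ := D.tildeCurve (U s).control (D.controlledCurve (U s)) t ℓ

namespace IsSmoothCurve

lemma contDiffOn_coord_jet (hT : 0 < T) (hU : D.IsSmoothCurve U) (ht : t ∈ Icc 0 T)
    (i : Fin N) {β : ℕ} (hβ : β ≤ n) :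
    ContDiffOn ℝ ∞ (fun s => coord (jet n T (D.controlledCurve (U s)) t) β i) (Icc 0 1) := by
  simp only [coord_jet hβ]
  exact ((hU.smoothOnRect_variation.dtn hT β).apply i).snd ht

lemma contDiffOn_momentum (hT : 0 < T) (hU : D.IsSmoothCurve U) {F : ℝ → Jet (Fin N) n → ℝ}
    (hF : SmoothFamily T D.Q F) (ht : t ∈ Icc 0 T) (i : Fin N) (β : ℕ) :
    ContDiffOn ℝ ∞ (fun s => momentum T D.Q r (F s) β i (jet n T (D.controlledCurve (U s)) t))
      (Icc 0 1) :=
  ((hF.momentum hT D.isOpen_Q β i).comp_jet hT hU.smoothOnRect_variation hU.variation_mem).snd ht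

/-- The boundary data are values and momenta at the two end points, hence smooth in `s`, and the
auxiliary functions depend linearly on their data. The data of h'' are themselves the end values of
h and of its derivative. -/
lemma smoothOnRect_tildeFamily (hT : 0 < T) (hrn : r ≤ n) (hU : D.IsSmoothCurve U)
    (ℓ : TildeIdx N r) : SmoothOnRect T (D.tildeFamily U ℓ) := by
  have h0 : (0 : ℝ) ∈ Icc 0 T := ⟨le_rfl, hT.le⟩
  have h1 : T ∈ Icc 0 T := ⟨hT.le, le_rfl⟩
  have hb : ∀ β : Fin r, (β : ℕ) ≤ n := fun β => β.2.le.trans hrn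
  have ha := fun i (β : Fin r) => hU.contDiffOn_coord_jet hT h0 i (hb β)
  have hm := fun i (β : Fin r) =>
    (hU.contDiffOn_momentum hT hU.smoothFamily_frozen h0 i β).neg
  cases ℓ with
  | q i => exact hU.smoothOnRect_variation.apply i
  | h i β => exact smoothOnRect_expFun (ha i β) (hm i β)
  | h' i β =>
    exact smoothOnRect_expTrigFun (hU.contDiffOn_coord_jet hT h1 i (hb β))
      (hU.contDiffOn_momentum hT (hU.smoothFamily_frozen_add hT) h1 i β)
  | h'' i β =>
    refine smoothOnRect_expTrigFun ((smoothOnRect_expFun (ha i β) (hm i β)).snd h1)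
      (((smoothOnRect_expFun (hm i β) (ha i β)).snd h1).congr fun s _ => ?_)
    exact (hasDerivAt_expFun _ _ T).deriv

end IsSmoothCurve

/-- The derivatives of the components of the associated curves. -/
lemma IsSmoothCurve.coord_jet_tilde (hT : 0 < T) (hrn : r ≤ n) (hU : D.IsSmoothCurve U)
    (ht : t ∈ Icc 0 T) (hs : s ∈ Icc (0 : ℝ) 1) {β : ℕ} (hβ : β ≤ n) (ℓ : TildeIdx N r) :
    coord (jet n T (D.tildeCurve (U s).control (D.controlledCurve (U s))) t) β ℓ =
      dtn T β (D.tildeFamily U ℓ) t s := by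
  rw [coord_jet hβ]
  exact iteratedDerivWithin_apply_pi hT
    (fun ℓ => (hU.smoothOnRect_tildeFamily hT hrn ℓ).fst hs) β ht ℓ

lemma IsSmoothCurve.base_jet_tilde (hT : 0 < T) (hrn : r ≤ n) (hU : D.IsSmoothCurve U)
    (ht : t ∈ Icc 0 T) (hs : s ∈ Icc (0 : ℝ) 1) :
    TildeIdx.base (jet n T (D.tildeCurve (U s).control (D.controlledCurve (U s))) t) =
      jet n T (D.controlledCurve (U s)) t := by
  refine Prod.ext rfl (funext fun β => funext fun i => ?_)
  have h1 := iteratedDerivWithin_apply_pi hT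
    (fun ℓ => (hU.smoothOnRect_tildeFamily hT hrn ℓ).fst hs) β ht (.q i)
  have h2 := iteratedDerivWithin_apply_pi hT
    (fun i => (hU.smoothOnRect_variation.apply i).fst hs) β ht i
  exact h1.trans h2.symm

/-- The Lagrangian along the controlled curves. -/
def lagrangianAlong (D : DefiningTriple N M n r T) (U : ℝ → ControlPair N M r) (t s : ℝ) : ℝ :=
  D.L (jet n T (D.controlledCurve (U s)) t) ((U s).control t)

/-- The part of the modified Lagrangian that involves the auxiliary functions. -/
def auxLagrangian (D : DefiningTriple N M n r T) (U : ℝ → ControlPair N M r) (t s : ℝ) : ℝ :=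
  1 / 2 * ∑ i : Fin N, ∑ β : Fin r,
      (dtn T 1 (D.tildeFamily U (.h i β)) t s ^ 2 - dtn T 2 (D.tildeFamily U (.h' i β)) t s ^ 2
        - dtn T 2 (D.tildeFamily U (.h'' i β)) t s ^ 2)
    + ∑ i : Fin N, ∑ β : Fin r,
        (1 / 2 * D.tildeFamily U (.h i β) t s ^ 2
          + Real.pi ^ 4 / (32 * T ^ 4) * D.tildeFamily U (.h' i β) t s ^ 2
          + Real.pi ^ 4 / (32 * T ^ 4) * D.tildeFamily U (.h'' i β) t s ^ 2)

/-- The modified Lagrangian along the associated curves. -/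
def LTildeAlong (D : DefiningTriple N M n r T) (U : ℝ → ControlPair N M r) (t s : ℝ) : ℝ :=
  D.LTilde (jet n T (D.tildeCurve (U s).control (D.controlledCurve (U s))) t) ((U s).control t)

namespace IsSmoothCurve

lemma smoothOnRect_lagrangianAlong (hT : 0 < T) (hU : D.IsSmoothCurve U) :
    SmoothOnRect T (D.lagrangianAlong U) :=
  hU.smoothFamily_frozen.comp_jet hT hU.smoothOnRect_variation hU.variation_mem

lemma smoothOnRect_auxLagrangian (hT : 0 < T) (hrn : r ≤ n) (hU : D.IsSmoothCurve U) :
    SmoothOnRect T (D.auxLagrangian U) := by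
  have hy := hU.smoothOnRect_tildeFamily hT hrn
  refine ((SmoothOnRect.const _).mul (.sum fun i _ => .sum fun β _ => ?_)).add
    (.sum fun i _ => .sum fun β _ => ?_)
  · exact ((((hy _).dtn hT 1).pow 2).sub (((hy _).dtn hT 2).pow 2)).sub (((hy _).dtn hT 2).pow 2)
  · exact (((SmoothOnRect.const _).mul ((hy _).pow 2)).add
      ((SmoothOnRect.const _).mul ((hy _).pow 2))).add ((SmoothOnRect.const _).mul ((hy _).pow 2))

lemma LTildeAlong_eq (hT : 0 < T) (hrn : r ≤ n) (hn : 2 ≤ n) (hU : D.IsSmoothCurve U)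
    (ht : t ∈ Icc 0 T) (hs : s ∈ Icc (0 : ℝ) 1) :
    D.LTildeAlong U t s = D.lagrangianAlong U t s + D.auxLagrangian U t s := by
  simp only [LTildeAlong, LTilde, hU.base_jet_tilde hT hrn ht hs,
    hU.coord_jet_tilde hT hrn ht hs (show 1 ≤ n by omega),
    hU.coord_jet_tilde hT hrn ht hs hn, hU.coord_jet_tilde hT hrn ht hs (Nat.zero_le n),
    dtn_zero, auxLagrangian, lagrangianAlong, add_assoc]

lemma smoothOnRect_LTildeAlong (hT : 0 < T) (hrn : r ≤ n) (hn : 2 ≤ n) (hU : D.IsSmoothCurve U) :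
    SmoothOnRect T (D.LTildeAlong U) :=
  ((hU.smoothOnRect_lagrangianAlong hT).add (hU.smoothOnRect_auxLagrangian hT hrn)).congr
    fun _ ht _ hs => hU.LTildeAlong_eq hT hrn hn ht hs

end IsSmoothCurve

/-! ### The jets of the associated curves -/

/-- The family of the curves `(q^i, h^i_β, h'^i_β, h''^i_β, λ, μ)`. -/
def hatFamily (D : DefiningTriple N M n r T) (U : ℝ → ControlPair N M r) (ℓ : HatIdx N r)
    (t s : ℝ) : ℝ := D.hatCurve (U s).control (D.controlledCurve (U s)) t ℓ

namespace IsSmoothCurve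

lemma hasDerivWithinAt_mu_fst (hT : 0 < T) (hrn : r ≤ n) (hn : 2 ≤ n) (hU : D.IsSmoothCurve U)
    (ht : t ∈ Icc 0 T) (hs : s ∈ Icc (0 : ℝ) 1) :
    HasDerivWithinAt (fun t => D.mu U t s) (-D.LTildeAlong U t s) (Icc 0 T) t :=
  (hasDerivWithinAt_integral_of_continuousOn hT.le
    ((hU.smoothOnRect_LTildeAlong hT hrn hn).continuousOn_fst hs) ht).neg

lemma hasDerivWithinAt_mu_snd (hT : 0 < T) (hrn : r ≤ n) (hn : 2 ≤ n) (hU : D.IsSmoothCurve U)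
    (ht : t ∈ Icc 0 T) (hs : s ∈ Icc (0 : ℝ) 1) :
    HasDerivWithinAt (fun s => D.mu U t s) (-∫ τ in (0 : ℝ)..t, ds (D.LTildeAlong U) τ s)
      (Icc 0 1) s :=
  ((hU.smoothOnRect_LTildeAlong hT hrn hn).hasDerivWithinAt_integral hT ht hs).neg

/-- The time derivative of μ is −L̃, which is already smooth along the curves. -/
lemma contDiffOn_mu (hT : 0 < T) (hrn : r ≤ n) (hn : 2 ≤ n) (hU : D.IsSmoothCurve U)
    (hs : s ∈ Icc (0 : ℝ) 1) : ContDiffOn ℝ ∞ (fun t => D.mu U t s) (Icc 0 T) := by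
  rw [contDiffOn_infty_iff_derivWithin (uniqueDiffOn_Icc hT)]
  refine ⟨fun t ht => (hU.hasDerivWithinAt_mu_fst hT hrn hn ht hs).differentiableWithinAt,
    (((hU.smoothOnRect_LTildeAlong hT hrn hn).fst hs).neg).congr fun t ht => ?_⟩
  exact (hU.hasDerivWithinAt_mu_fst hT hrn hn ht hs).derivWithin (uniqueDiffOn_Icc hT t ht)

lemma contDiffOn_hatFamily (hT : 0 < T) (hrn : r ≤ n) (hn : 2 ≤ n) (hU : D.IsSmoothCurve U)
    (hs : s ∈ Icc (0 : ℝ) 1) (ℓ : HatIdx N r) :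
    ContDiffOn ℝ ∞ (fun t => D.hatFamily U ℓ t s) (Icc 0 T) := by
  cases ℓ with
  | tilde ℓ => exact (hU.smoothOnRect_tildeFamily hT hrn ℓ).fst hs
  | lam => exact contDiffOn_const
  | mu => exact hU.contDiffOn_mu hT hrn hn hs

lemma differentiableWithinAt_dtn_hatFamily (hT : 0 < T) (hrn : r ≤ n) (hn : 2 ≤ n)
    (hU : D.IsSmoothCurve U) (ht : t ∈ Icc 0 T) (hs : s ∈ Icc (0 : ℝ) 1) (β : ℕ)
    (ℓ : HatIdx N r) :
    DifferentiableWithinAt ℝ (fun s => dtn T β (D.hatFamily U ℓ) t s) (Icc 0 1) s := by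
  cases ℓ with
  | tilde ℓ =>
    exact (((hU.smoothOnRect_tildeFamily hT hrn ℓ).dtn hT β).hasDerivWithinAt_snd
      ht hs).differentiableWithinAt
  | lam =>
    exact (((SmoothOnRect.const (1 : ℝ)).dtn hT β).hasDerivWithinAt_snd
      ht hs).differentiableWithinAt
  | mu =>
    -- μ itself is handled by differentiation under the integral sign. Its higher time derivatives
    -- are those of the jointly smooth −L̃, so joint smoothness of μ is never needed.
    cases β with
    | zero =>
      simp only [dtn_zero]
      exact (hU.hasDerivWithinAt_mu_snd hT hrn hn ht hs).differentiableWithinAt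
    | succ β =>
      have he : ∀ s ∈ Icc (0 : ℝ) 1, dtn T (β + 1) (D.hatFamily U .mu) t s =
          dtn T β (fun t s => -D.LTildeAlong U t s) t s := fun s hs => by
        simp only [dtn, iteratedDerivWithin_succ']
        exact iteratedDerivWithin_congr (fun x hx => (hU.hasDerivWithinAt_mu_fst hT hrn hn
          hx hs).derivWithin (uniqueDiffOn_Icc hT x hx)) ht
      exact ((((hU.smoothOnRect_LTildeAlong hT hrn hn).neg.dtn hT β).hasDerivWithinAt_snd
        ht hs).congr he (he s hs)).differentiableWithinAt

lemma hasDerivWithinAt_hatJet (hT : 0 < T) (hrn : r ≤ n) (hn : 2 ≤ n)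
    (hU : D.IsSmoothCurve U) (ht : t ∈ Icc 0 T) (hs : s ∈ Icc (0 : ℝ) 1) :
    HasDerivWithinAt (fun s => D.hatJet U t s)
      (((0, fun β ℓ => ds (dtn T β (D.hatFamily U ℓ)) t s) : Jet (HatIdx N r) n),
        ds (fun t s => (U s).control t) t s) (Icc 0 1) s :=
  (hasDerivWithinAt_jet hT (fun _ hs' ℓ => hU.contDiffOn_hatFamily hT hrn hn hs' ℓ) ht hs
    fun β ℓ => hU.differentiableWithinAt_dtn_hatFamily hT hrn hn ht hs β ℓ).prodMk
    (hU.smoothOnRect_control.hasDerivWithinAt_snd ht hs)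

lemma YHat_eq (hT : 0 < T) (hrn : r ≤ n) (hn : 2 ≤ n)
    (hU : D.IsSmoothCurve U) (ht : t ∈ Icc 0 T) (hs : s ∈ Icc (0 : ℝ) 1) :
    D.YHat U t s = (((0, fun β ℓ => ds (dtn T β (D.hatFamily U ℓ)) t s) : Jet (HatIdx N r) n),
        ds (fun t s => (U s).control t) t s) :=
  (hU.hasDerivWithinAt_hatJet hT hrn hn ht hs).derivWithin (uniqueDiffOn_Icc zero_lt_one s hs)

lemma coord_YHat (hT : 0 < T) (hrn : r ≤ n) (hn : 2 ≤ n)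
    (hU : D.IsSmoothCurve U) (ht : t ∈ Icc 0 T) (hs : s ∈ Icc (0 : ℝ) 1) {β : ℕ} (hβ : β ≤ n)
    (ℓ : HatIdx N r) :
    coord (D.YHat U t s).1 β ℓ = ds (dtn T β (D.hatFamily U ℓ)) t s := by
  rw [hU.YHat_eq hT hrn hn ht hs]
  simp [coord, Nat.lt_succ_of_le hβ]

lemma coord_hatJet (hT : 0 < T) (hrn : r ≤ n) (hn : 2 ≤ n)
    (hU : D.IsSmoothCurve U) (ht : t ∈ Icc 0 T) (hs : s ∈ Icc (0 : ℝ) 1) {β : ℕ} (hβ : β ≤ n)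
    (ℓ : HatIdx N r) :
    coord (D.hatJet U t s).1 β ℓ = dtn T β (D.hatFamily U ℓ) t s := by
  simp only [hatJet]
  rw [coord_jet hβ]
  exact iteratedDerivWithin_apply_pi hT
    (fun ℓ => hU.contDiffOn_hatFamily hT hrn hn hs ℓ) β ht ℓ

lemma base_hatJet (hT : 0 < T) (hrn : r ≤ n) (hn : 2 ≤ n)
    (hU : D.IsSmoothCurve U) (ht : t ∈ Icc 0 T) (hs : s ∈ Icc (0 : ℝ) 1) :
    TildeIdx.base (HatIdx.toTilde (D.hatJet U t s).1) =
      jet n T (D.controlledCurve (U s)) t := by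
  refine Prod.ext rfl (funext fun β => funext fun i => ?_)
  have h1 := iteratedDerivWithin_apply_pi hT
    (fun ℓ => hU.contDiffOn_hatFamily hT hrn hn hs ℓ) β ht (.tilde (.q i))
  have h2 := iteratedDerivWithin_apply_pi hT
    (fun i => (hU.smoothOnRect_variation.apply i).fst hs) β ht i
  exact h1.trans h2.symm

lemma Y_snd (hT : 0 < T) (hU : D.IsSmoothCurve U) (ht : t ∈ Icc 0 T) (hs : s ∈ Icc (0 : ℝ) 1) :
    (D.Y U t s).2 = ds (fun t s => (U s).control t) t s :=
  congrArg Prod.snd (((hasDerivWithinAt_jet_of_smooth (n := n) hT hU.smoothOnRect_variation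
    ht hs).prodMk (hU.smoothOnRect_control.hasDerivWithinAt_snd ht hs)).derivWithin
      (uniqueDiffOn_Icc zero_lt_one s hs))

end IsSmoothCurve

end DefiningTriple

namespace DefiningTriple

variable {N M n r : ℕ} {T : ℝ} {D : DefiningTriple N M n r T} {U : ℝ → ControlPair N M r}
  {t s : ℝ}

/-! ## Variation formulas -/

/-- The sum of the terms `h'^i_{β(3)} Y'^i_{β(0)} + h''^i_{β(3)} Y''^i_{β(0)}`. -/
def muCorrection (D : DefiningTriple N M n r T) (U : ℝ → ControlPair N M r) (t s : ℝ) : ℝ :=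
  ∑ β : Fin r, ∑ i : Fin N,
    (dtn T 3 (D.tildeFamily U (.h' i β)) t s * ds (D.tildeFamily U (.h' i β)) t s
      + dtn T 3 (D.tildeFamily U (.h'' i β)) t s * ds (D.tildeFamily U (.h'' i β)) t s)

/-- The part of `α^{PC}(Y_F̂)` that involves the auxiliary functions. -/
def auxPairing (D : DefiningTriple N M n r T) (U : ℝ → ControlPair N M r) (t s : ℝ) : ℝ :=
  ∑ i : Fin N, ∑ β : Fin r,
    (dtn T 1 (D.tildeFamily U (.h i β)) t s * ds (D.tildeFamily U (.h i β)) t s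
      + (dtn T 3 (D.tildeFamily U (.h' i β)) t s * ds (D.tildeFamily U (.h' i β)) t s
        - dtn T 2 (D.tildeFamily U (.h' i β)) t s
          * ds (dtn T 1 (D.tildeFamily U (.h' i β))) t s)
      + (dtn T 3 (D.tildeFamily U (.h'' i β)) t s * ds (D.tildeFamily U (.h'' i β)) t s
        - dtn T 2 (D.tildeFamily U (.h'' i β)) t s
          * ds (dtn T 1 (D.tildeFamily U (.h'' i β))) t s))

/-- The part of `α^{PC}(Y_F̂)` that involves the momenta of the Lagrangian. -/
def lagrangianPairing (D : DefiningTriple N M n r T) (U : ℝ → ControlPair N M r) : ℝ → ℝ → ℝ :=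
  momentumPairing n r T D.Q (fun s => frozen D.L (U s).control) (D.variation U)

/-- The part of `α^{PC}(Y_F̂)` that involves the momenta of the sum of the Lagrangian and of the
total derivative of the cost. -/
def totalPairing (D : DefiningTriple N M n r T) (U : ℝ → ControlPair N M r) : ℝ → ℝ → ℝ :=
  momentumPairing n r T D.Q (fun s p => frozen D.L (U s).control p + D.dC p) (D.variation U)

/-- The term β = r, present in the definition so that the telescoping sum ends in zero, is dropped
here to match the range of indices of the auxiliary functions. -/
lemma momentumPairing_eq_sum_fin (F : ℝ → Jet (Fin N) n → ℝ) (q : ℝ → ℝ → Fin N → ℝ)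
    (Q : Set (Fin N → ℝ)) :
    momentumPairing n r T Q F q t s = ∑ i, ∑ β : Fin r,
      momentum T Q r (F s) β i (jet n T (fun t => q t s) t) *
        ds (dtn T β fun t s => q t s i) t s := by
  refine Finset.sum_congr rfl fun i _ => ?_
  rw [Finset.sum_range_succ, momentum_self, zero_mul, add_zero, Finset.sum_range]

/-- The cost along the controlled curves. -/
def costAlong (D : DefiningTriple N M n r T) (U : ℝ → ControlPair N M r) (t s : ℝ) : ℝ :=
  D.C (jet n T (D.controlledCurve (U s)) t)

namespace IsSmoothCurve

lemma smoothOnRect_costAlong (hT : 0 < T) (hU : D.IsSmoothCurve U) :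
    SmoothOnRect T (D.costAlong U) :=
  (SmoothFamily.const D.smooth_C).comp_jet hT hU.smoothOnRect_variation hU.variation_mem

lemma smoothOnRect_muCorrection (hT : 0 < T) (hrn : r ≤ n) (hU : D.IsSmoothCurve U) :
    SmoothOnRect T (D.muCorrection U) := by
  have hy := hU.smoothOnRect_tildeFamily hT hrn
  exact .sum fun β _ => .sum fun i _ => (((hy _).dtn hT 3).mul ((hy _).ds hT)).add
    (((hy _).dtn hT 3).mul ((hy _).ds hT))

lemma smoothOnRect_auxPairing (hT : 0 < T) (hrn : r ≤ n) (hU : D.IsSmoothCurve U) :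
    SmoothOnRect T (D.auxPairing U) := by
  have hy := hU.smoothOnRect_tildeFamily hT hrn
  have h2 := fun ℓ => (((hy ℓ).dtn hT 3).mul ((hy ℓ).ds hT)).sub
    (((hy ℓ).dtn hT 2).mul (((hy ℓ).dtn hT 1).ds hT))
  exact .sum fun i _ => .sum fun β _ =>
    ((((hy _).dtn hT 1).mul ((hy _).ds hT)).add (h2 _)).add (h2 _)

lemma smoothOnRect_lagrangianPairing (hT : 0 < T) (hU : D.IsSmoothCurve U) :
    SmoothOnRect T (D.lagrangianPairing U) :=
  smoothOnRect_momentumPairing hT D.isOpen_Q hU.smoothOnRect_variation hU.variation_mem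
    hU.smoothFamily_frozen

lemma dtn_two_h (hT : 0 < T) (ht : t ∈ Icc 0 T) (i : Fin N) (β : Fin r) :
    dtn T 2 (D.tildeFamily U (.h i β)) t s = D.tildeFamily U (.h i β) t s :=
  iteratedDerivWithin_two_expFun hT _ _ ht

lemma dtn_four_h' (hT : 0 < T) (ht : t ∈ Icc 0 T) (i : Fin N) (β : Fin r) :
    dtn T 4 (D.tildeFamily U (.h' i β)) t s =
      Real.pi ^ 4 / (16 * T ^ 4) * D.tildeFamily U (.h' i β) t s :=
  iteratedDerivWithin_four_expTrigFun hT _ _ ht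

lemma dtn_four_h'' (hT : 0 < T) (ht : t ∈ Icc 0 T) (i : Fin N) (β : Fin r) :
    dtn T 4 (D.tildeFamily U (.h'' i β)) t s =
      Real.pi ^ 4 / (16 * T ^ 4) * D.tildeFamily U (.h'' i β) t s :=
  iteratedDerivWithin_four_expTrigFun hT _ _ ht

/-- The auxiliary functions are extremals of the auxiliary Lagrangian. -/
lemma dt_auxPairing (hT : 0 < T) (hrn : r ≤ n) (hU : D.IsSmoothCurve U) (ht : t ∈ Icc 0 T)
    (hs : s ∈ Icc (0 : ℝ) 1) : dt T (D.auxPairing U) t s = ds (D.auxLagrangian U) t s := by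
  have hy := hU.smoothOnRect_tildeFamily hT hrn
  have hyd := fun ℓ => (hy ℓ).hasDerivWithinAt_snd ht hs
  have hyd1 := fun ℓ => ((hy ℓ).dtn hT 1).hasDerivWithinAt_snd ht hs
  have hyd2 := fun ℓ => ((hy ℓ).dtn hT 2).hasDerivWithinAt_snd ht hs
  have h1 := HasDerivWithinAt.fun_sum (u := (Finset.univ : Finset (Fin N))) fun i _ =>
    HasDerivWithinAt.fun_sum (u := (Finset.univ : Finset (Fin r))) fun β _ =>
    (((hy (.h i β)).hasDerivWithinAt_pairing_one hT ht hs (dtn_two_h hT ht i β)).add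
    ((hy (.h' i β)).hasDerivWithinAt_pairing_two hT ht hs (dtn_four_h' hT ht i β))).add
    ((hy (.h'' i β)).hasDerivWithinAt_pairing_two hT ht hs (dtn_four_h'' hT ht i β))
  have h2 := ((HasDerivWithinAt.fun_sum (u := (Finset.univ : Finset (Fin N))) fun i _ =>
    HasDerivWithinAt.fun_sum (u := (Finset.univ : Finset (Fin r))) fun β _ =>
    (((hyd1 (.h i β)).fun_pow 2).sub ((hyd2 (.h' i β)).fun_pow 2)).sub
      ((hyd2 (.h'' i β)).fun_pow 2)).const_mul (1 / 2 : ℝ)).add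
    (HasDerivWithinAt.fun_sum (u := (Finset.univ : Finset (Fin N))) fun i _ =>
    HasDerivWithinAt.fun_sum (u := (Finset.univ : Finset (Fin r))) fun β _ =>
    ((((hyd (.h i β)).fun_pow 2).const_mul (1 / 2 : ℝ)).add
      (((hyd (.h' i β)).fun_pow 2).const_mul (Real.pi ^ 4 / (32 * T ^ 4)))).add
      (((hyd (.h'' i β)).fun_pow 2).const_mul (Real.pi ^ 4 / (32 * T ^ 4))))
  have e1 : dt T (D.auxPairing U) t s = _ := h1.derivWithin (uniqueDiffOn_Icc hT t ht)
  have e2 : ds (D.auxLagrangian U) t s = _ := h2.derivWithin (uniqueDiffOn_Icc zero_lt_one s hs)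
  rw [e1, e2, Finset.mul_sum, ← Finset.sum_add_distrib]
  refine Finset.sum_congr rfl fun i _ => ?_
  rw [Finset.mul_sum, ← Finset.sum_add_distrib]
  refine Finset.sum_congr rfl fun β _ => ?_
  have hc : Real.pi ^ 4 / (16 * T ^ 4) = 2 * (Real.pi ^ 4 / (32 * T ^ 4)) := by
    field_simp
    norm_num
  rw [hc]
  push_cast
  ring

/-- The part of the variation of the Lagrangian that comes from the variation of the controls. -/
lemma sum_control_variation (hT : 0 < T) (hU : D.IsSmoothCurve U) (ht : t ∈ Icc 0 T)
    (hs : s ∈ Icc (0 : ℝ) 1) :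
    ∑ a : Fin M, (D.Y U t s).2 a *
        D.partialP (jet n T (D.controlledCurve (U s)) t) a ((U s).control t) =
      fderivWithin ℝ (frozen D.L (U s).control) (jetDomain N n T D.Q)
        (jet n T (D.controlledCurve (U s)) t)
        (0, fun β i => ds (dtn T β fun t s => D.variation U t s i) t s)
      - ds (D.lagrangianAlong U) t s := by
  set p := jet n T (D.controlledCurve (U s)) t with hp
  set w := (U s).control t with hw
  set v : Jet (Fin N) n := (0, fun β i => ds (dtn T β fun t s => D.variation U t s i) t s) with hv
  have hpX : p ∈ jetDomain N n T D.Q := hU.jet_mem ht hs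
  have hwK : w ∈ D.K := hU.control_mem ht hs
  have hJ : HasDerivWithinAt (fun s => jet n T (D.controlledCurve (U s)) t) v (Icc 0 1) s :=
    hasDerivWithinAt_jet_of_smooth hT hU.smoothOnRect_variation ht hs
  have hu := hU.smoothOnRect_control.hasDerivWithinAt_snd ht hs
  set z := ds (fun t s => (U s).control t) t s with hz
  have hs' : UniqueDiffWithinAt ℝ (Icc (0 : ℝ) 1) s := uniqueDiffOn_Icc zero_lt_one s hs
  obtain ⟨A, hA⟩ : DifferentiableWithinAt ℝ (fun x : Jet (Fin N) n × (Fin M → ℝ) => D.L x.1 x.2)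
      (jetDomain N n T D.Q ×ˢ D.K) (p, w) :=
    D.smooth_L.differentiableOn (by simp) _ ⟨hpX, hwK⟩
  have e1 : ds (D.lagrangianAlong U) t s = A (v, z) :=
    (hA.comp_hasDerivWithinAt s (f := fun s => (jet n T (D.controlledCurve (U s)) t,
      (U s).control t)) (hJ.prodMk hu)
      fun s' hs' => ⟨hU.jet_mem ht hs', hU.control_mem ht hs'⟩).derivWithin hs'
  -- The frozen Lagrangian also depends on time through the control, but `v` has no time component,
  -- so that dependence contributes nothing.
  have e2 : fderivWithin ℝ (frozen D.L (U s).control) (jetDomain N n T D.Q) p v = A (v, 0) := by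
    have hcu : HasFDerivWithinAt (fun x : Jet (Fin N) n => (U s).control x.1)
        (ContinuousLinearMap.comp (fderivWithin ℝ (U s).control (Icc 0 T) t)
          (ContinuousLinearMap.fst ℝ ℝ (Fin (n + 1) → Fin N → ℝ))) (jetDomain N n T D.Q) p :=
      HasFDerivWithinAt.comp p
        (((hU.smoothOnRect_control.fst hs).differentiableOn (by simp) t ht).hasFDerivWithinAt)
        hasFDerivWithinAt_fst fun x hx => hx.1
    have h := (HasFDerivWithinAt.comp (t := jetDomain N n T D.Q ×ˢ D.K)
      (f := fun x : Jet (Fin N) n => (x, (U s).control x.1)) p hA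
      ((hasFDerivWithinAt_id p _).prodMk hcu) fun x hx => ⟨hx, hU.control_mem hx.1 hs⟩).fderivWithin
        (uniqueDiffOn_jetDomain hT D.isOpen_Q p hpX)
    refine (congrArg (fun B => B v) h).trans ?_
    simp [hv]
  have e3 : fderivWithin ℝ (D.P p) D.K w z = -A (0, z) := by
    have hPA : HasFDerivWithinAt (D.P p) (-(A.comp
        ((0 : (Fin M → ℝ) →L[ℝ] Jet (Fin N) n).prod (ContinuousLinearMap.id ℝ _)))) D.K w :=
      (HasFDerivWithinAt.comp (t := jetDomain N n T D.Q ×ˢ D.K)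
        (f := fun x : Fin M → ℝ => (p, x)) w hA
        ((hasFDerivWithinAt_const p w D.K).prodMk (hasFDerivWithinAt_id w D.K))
        fun x hx => ⟨hpX, hx⟩).neg
    -- No uniqueness of derivatives within `K` is invoked. Composed with the curve of controls in
    -- `K`, whose velocity is `z`, both candidates compute the same one-variable derivative, so they
    -- agree on `z`.
    have h1 := hPA.comp_hasDerivWithinAt s hu fun s' hs' => hU.control_mem ht hs'
    have h2 := hPA.differentiableWithinAt.hasFDerivWithinAt.comp_hasDerivWithinAt s hu
      fun s' hs' => hU.control_mem ht hs'
    exact hs'.eq_deriv _ h2 h1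
  have e4 : ∑ a : Fin M, z a * D.partialP p a w = fderivWithin ℝ (D.P p) D.K w z := by
    conv_rhs => rw [pi_eq_sum_univ' z, map_sum]
    refine Finset.sum_congr rfl fun a _ => ?_
    rw [map_smul, smul_eq_mul, partialP]
  have e5 : A (v, z) = A (v, 0) + A (0, z) := by
    rw [← map_add]
    simp
  rw [hU.Y_snd hT ht hs, ← hz, e4, e3, e1, e2, e5]
  ring

lemma dt_lagrangianPairing (hT : 0 < T) (hr : 1 ≤ r) (hrn : 2 * r ≤ n) (hU : D.IsSmoothCurve U)
    (ht : t ∈ Icc 0 T) (hs : s ∈ Icc (0 : ℝ) 1) :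
    dt T (D.lagrangianPairing U) t s =
      fderivWithin ℝ (frozen D.L (U s).control) (jetDomain N n T D.Q)
        (jet n T (D.controlledCurve (U s)) t)
        (0, fun β i => ds (dtn T β fun t s => D.variation U t s i) t s) :=
  (hasDerivWithinAt_momentumPairing hT D.isOpen_Q hr hrn hU.smoothOnRect_variation
    hU.variation_mem hU.smoothFamily_frozen (hU.hasOrder_frozen hs) ht hs
    ((hU.isSolution hs).equations t ht)).derivWithin (uniqueDiffOn_Icc hT t ht)

/-! ### The function `μ'` -/

lemma ds_mu' (hT : 0 < T) (hrn : r ≤ n) (hn : 3 ≤ n) (hU : D.IsSmoothCurve U)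
    (ht : t ∈ Icc 0 T) (hs : s ∈ Icc (0 : ℝ) 1) :
    ds (D.mu' U) t s = -(∫ τ in (0 : ℝ)..t, ds (D.LTildeAlong U) τ s) + D.muCorrection U t s := by
  have hn2 : 2 ≤ n := by omega
  have hy := hU.smoothOnRect_tildeFamily hT hrn
  have hI : ∀ (i : Fin N) (β : Fin r), HasDerivWithinAt (fun s => ∫ v in (0 : ℝ)..s,
      (coord (D.hatJet U t v).1 3 (.tilde (.h' i β)) * coord (D.YHat U t v).1 0 (.tilde (.h' i β))
      + coord (D.hatJet U t v).1 3 (.tilde (.h'' i β))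
        * coord (D.YHat U t v).1 0 (.tilde (.h'' i β))))
      (dtn T 3 (D.tildeFamily U (.h' i β)) t s * ds (D.tildeFamily U (.h' i β)) t s
      + dtn T 3 (D.tildeFamily U (.h'' i β)) t s * ds (D.tildeFamily U (.h'' i β)) t s)
      (Icc 0 1) s := by
    intro i β
    have he : ∀ v ∈ Icc (0 : ℝ) 1, coord (D.hatJet U t v).1 3 (.tilde (.h' i β))
          * coord (D.YHat U t v).1 0 (.tilde (.h' i β))
        + coord (D.hatJet U t v).1 3 (.tilde (.h'' i β))
          * coord (D.YHat U t v).1 0 (.tilde (.h'' i β)) =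
        dtn T 3 (D.tildeFamily U (.h' i β)) t v * ds (D.tildeFamily U (.h' i β)) t v
        + dtn T 3 (D.tildeFamily U (.h'' i β)) t v * ds (D.tildeFamily U (.h'' i β)) t v := by
      intro v hv
      rw [hU.coord_hatJet hT hrn hn2 ht hv hn, hU.coord_hatJet hT hrn hn2 ht hv hn,
        hU.coord_YHat hT hrn hn2 ht hv (Nat.zero_le n),
        hU.coord_YHat hT hrn hn2 ht hv (Nat.zero_le n), dtn_zero, dtn_zero]
      rfl
    rw [← he s hs]
    refine hasDerivWithinAt_integral_of_continuousOn zero_le_one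
      (ContinuousOn.congr ?_ fun v hv => he v hv) hs
    exact ((((hy (.h' i β)).dtn hT 3).mul ((hy (.h' i β)).ds hT)).add
      (((hy (.h'' i β)).dtn hT 3).mul ((hy (.h'' i β)).ds hT))).continuousOn_snd ht
  exact ((hU.hasDerivWithinAt_mu_snd hT hrn hn2 ht hs).add (HasDerivWithinAt.fun_sum fun β _ =>
    HasDerivWithinAt.fun_sum fun i _ => hI i β)).derivWithin (uniqueDiffOn_Icc zero_lt_one s hs)

/-- The `s`-derivative of μ' is a time integral of −δL̃ plus the correction W, and the fundamental
theorem in `t` removes the integral. -/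
lemma mixedDerivMu'_eq (hT : 0 < T) (hrn : r ≤ n) (hn : 3 ≤ n) (hU : D.IsSmoothCurve U)
    (ht : t ∈ Icc 0 T) (hs : s ∈ Icc (0 : ℝ) 1) :
    D.mixedDerivMu' U t s = -ds (D.LTildeAlong U) t s + dt T (D.muCorrection U) t s := by
  have hc := (((hU.smoothOnRect_LTildeAlong hT hrn (by omega)).ds hT).continuousOn_fst hs)
  have h := (hasDerivWithinAt_integral_of_continuousOn hT.le hc ht).neg.add
    ((hU.smoothOnRect_muCorrection hT hrn).hasDerivWithinAt_fst hT ht hs)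
  exact (h.congr (fun t' ht' => hU.ds_mu' hT hrn hn ht' hs)
    (hU.ds_mu' hT hrn hn ht hs)).derivWithin (uniqueDiffOn_Icc hT t ht)

lemma integral_mixedDerivMu' (hT : 0 < T) (hrn : r ≤ n) (hn : 3 ≤ n) (hU : D.IsSmoothCurve U)
    (hs : s ∈ Icc (0 : ℝ) 1) :
    ∫ t in (0 : ℝ)..T, D.mixedDerivMu' U t s =
      -(∫ t in (0 : ℝ)..T, ds (D.LTildeAlong U) t s)
        + (D.muCorrection U T s - D.muCorrection U 0 s) := by
  have hL := ((hU.smoothOnRect_LTildeAlong hT hrn (by omega)).ds hT).neg.continuousOn_fst hs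
  have hW := ((hU.smoothOnRect_muCorrection hT hrn).dt hT).continuousOn_fst hs
  rw [← (hU.smoothOnRect_muCorrection hT hrn).integral_dt hT hs,
    ← intervalIntegral.integral_neg, ← intervalIntegral.integral_add
      (hL.intervalIntegrable_of_Icc hT.le) (hW.intervalIntegrable_of_Icc hT.le)]
  refine intervalIntegral.integral_congr fun t ht => ?_
  rw [uIcc_of_le hT.le] at ht
  exact hU.mixedDerivMu'_eq hT hrn hn ht hs

end IsSmoothCurve

end DefiningTriple

lemma ds_congr {E : Type*} [NormedAddCommGroup E] [NormedSpace ℝ E] {f g : ℝ → ℝ → E} {t s : ℝ}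
    (h : ∀ s ∈ Icc (0 : ℝ) 1, f t s = g t s) (hs : s ∈ Icc (0 : ℝ) 1) : ds f t s = ds g t s :=
  derivWithin_congr h (h s hs)

lemma ds_eq_zero {f : ℝ → ℝ → ℝ} {t s : ℝ}
    (h : ∀ s ∈ Icc (0 : ℝ) 1, f t s = 0) (hs : s ∈ Icc (0 : ℝ) 1) : ds f t s = 0 :=
  (derivWithin_congr (f := fun _ => (0 : ℝ)) h (h s hs)).trans (by simp)

namespace DefiningTriple

variable {N M n r : ℕ} {T : ℝ} {D : DefiningTriple N M n r T} {U : ℝ → ControlPair N M r}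
  {t s : ℝ}

namespace IsSmoothCurve

/-! ## Boundary values -/

lemma coord_jet_variation (hT : 0 < T) (hU : D.IsSmoothCurve U) (ht : t ∈ Icc 0 T)
    (hs : s ∈ Icc (0 : ℝ) 1) {β : ℕ} (hβ : β ≤ n) (i : Fin N) :
    coord (jet n T (D.controlledCurve (U s)) t) β i =
      dtn T β (fun t s => D.variation U t s i) t s := by
  rw [coord_jet hβ]
  exact dtn_apply hT hU.smoothOnRect_variation β ht hs i

lemma momentum_add_dC (hT : 0 < T) (hrn : r ≤ n) (hU : D.IsSmoothCurve U) (ht : t ∈ Icc 0 T)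
    (hs : s ∈ Icc (0 : ℝ) 1) {β : ℕ} (hβ : β ≤ r) (i : Fin N) :
    momentum T D.Q r (fun p => frozen D.L (U s).control p + D.dC p) β i
        (jet n T (D.controlledCurve (U s)) t) =
      momentum T D.Q r (frozen D.L (U s).control) β i (jet n T (D.controlledCurve (U s)) t)
        + partialQ T D.Q D.C β i (jet n T (D.controlledCurve (U s)) t) := by
  rw [momentum_add hT D.isOpen_Q (hU.smoothFamily_frozen.slice hs) (D.contDiffOn_dC hT) β i
    (hU.jet_mem ht hs), dC, momentum_totalDeriv hT D.isOpen_Q hrn D.smooth_C D.order_C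
    D.costOrder_succ_le hβ i (hU.jet_mem ht hs)]

/-- The momenta of dC/dt are ∂C/∂q_(β), and pairing them with δq_(β) is the chain rule for the cost
along the variation. -/
lemma totalPairing_eq (hT : 0 < T) (hrn : r ≤ n) (hU : D.IsSmoothCurve U) (ht : t ∈ Icc 0 T)
    (hs : s ∈ Icc (0 : ℝ) 1) :
    D.totalPairing U t s = D.lagrangianPairing U t s + ds (D.costAlong U) t s := by
  have hC : ds (D.costAlong U) t s = _ :=
    ((D.smooth_C.differentiableOn (by simp) _
      (hU.jet_mem ht hs)).hasFDerivWithinAt.comp_hasDerivWithinAt s (hasDerivWithinAt_jet_of_smooth hT hU.smoothOnRect_variation ht hs)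
      fun s' hs' => hU.jet_mem ht hs').derivWithin (uniqueDiffOn_Icc zero_lt_one s hs)
  rw [hC, (D.order_C.mono ((Nat.le_succ _).trans D.costOrder_succ_le)).fderivWithin_vertical
    D.isOpen_Q hrn (hU.jet_mem ht hs)
    fun β i => ds (dtn T β fun t s => D.variation U t s i) t s, totalPairing, lagrangianPairing,
    momentumPairing, momentumPairing, ← Finset.sum_add_distrib]
  refine Finset.sum_congr rfl fun i _ => ?_
  rw [← Finset.sum_add_distrib]
  refine Finset.sum_congr rfl fun β hβ => ?_
  rw [← add_mul]
  exact congrArg (· * _) (hU.momentum_add_dC hT hrn ht hs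
    (Nat.lt_succ_iff.1 (Finset.mem_range.1 hβ)) i)

lemma ds_costAlong_zero (hT : 0 < T) (hU : D.IsSmoothCurve U) (hs : s ∈ Icc (0 : ℝ) 1) :
    ds (D.costAlong U) 0 s = 0 :=
  ds_eq_zero (fun _ hs' => D.C_zero _ (hU.jet_mem ⟨le_rfl, hT.le⟩ hs') rfl) hs

lemma muCorrection_zero (hT : 0 < T) (hs : s ∈ Icc (0 : ℝ) 1) : D.muCorrection U 0 s = 0 := by
  refine Finset.sum_eq_zero fun β _ => Finset.sum_eq_zero fun i _ => ?_
  rw [ds_eq_zero (f := D.tildeFamily U (.h' i β)) (fun s _ => expTrigFun_zero hT _ _) hs,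
    ds_eq_zero (f := D.tildeFamily U (.h'' i β)) (fun s _ => expTrigFun_zero hT _ _) hs]
  ring

/-- At the initial time only h_(1) δh survives, and the data of h turn it into −π^β δq_(β). -/
lemma auxPairing_zero (hT : 0 < T) (hrn : r ≤ n) (hU : D.IsSmoothCurve U)
    (hs : s ∈ Icc (0 : ℝ) 1) : D.auxPairing U 0 s = -D.lagrangianPairing U 0 s := by
  have h0 : (0 : ℝ) ∈ Icc 0 T := ⟨le_rfl, hT.le⟩
  rw [auxPairing, lagrangianPairing, momentumPairing_eq_sum_fin, ← Finset.sum_neg_distrib]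
  refine Finset.sum_congr rfl fun i _ => ?_
  rw [← Finset.sum_neg_distrib]
  refine Finset.sum_congr rfl fun β _ => ?_
  rw [ds_eq_zero (f := D.tildeFamily U (.h' i β)) (fun s _ => expTrigFun_zero hT _ _) hs,
    ds_eq_zero (f := D.tildeFamily U (.h'' i β)) (fun s _ => expTrigFun_zero hT _ _) hs,
    ds_eq_zero (f := dtn T 1 (D.tildeFamily U (.h' i β)))
      (fun s _ => iteratedDerivWithin_one_expTrigFun_zero hT _ _) hs,
    ds_eq_zero (f := dtn T 1 (D.tildeFamily U (.h'' i β)))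
      (fun s _ => iteratedDerivWithin_one_expTrigFun_zero hT _ _) hs]
  have e1 : dtn T 1 (D.tildeFamily U (.h i β)) 0 s =
      -momentum T D.Q r (frozen D.L (U s).control) β i (jet n T (D.controlledCurve (U s)) 0) :=
    (iteratedDerivWithin_one_expFun hT _ _ h0).trans (expFun_zero _ _)
  have e2 : ds (D.tildeFamily U (.h i β)) 0 s =
      ds (dtn T β fun t s => D.variation U t s i) 0 s :=
    ds_congr (fun s hs => (expFun_zero _ _).trans
      (hU.coord_jet_variation hT h0 hs (β.2.le.trans hrn) i)) hs
  rw [e1, e2]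
  simp only [mul_zero, sub_zero, add_zero, neg_mul]
  rfl

/-- At the final time the data of h'' make −h''_(2) δh''_(1) cancel h_(1) δh, and the data of h'
make −h'_(2) δh'_(1) the pairing of the momenta of L^u + dC/dt. The third-order terms, not fixed by
the boundary conditions, are exactly W. -/
lemma auxPairing_right (hT : 0 < T) (hrn : r ≤ n) (hU : D.IsSmoothCurve U)
    (hs : s ∈ Icc (0 : ℝ) 1) :
    D.auxPairing U T s = D.muCorrection U T s - D.totalPairing U T s := by
  have h1 : T ∈ Icc 0 T := ⟨hT.le, le_rfl⟩
  rw [auxPairing, muCorrection, Finset.sum_comm (γ := Fin r), totalPairing,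
    momentumPairing_eq_sum_fin, ← Finset.sum_sub_distrib]
  refine Finset.sum_congr rfl fun i _ => ?_
  rw [← Finset.sum_sub_distrib]
  refine Finset.sum_congr rfl fun β _ => ?_
  have e1 : dtn T 2 (D.tildeFamily U (.h' i β)) T s = momentum T D.Q r
      (fun p => frozen D.L (U s).control p + D.dC p) β i (jet n T (D.controlledCurve (U s)) T) :=
    iteratedDerivWithin_two_expTrigFun_right hT _ _
  have e2 : ds (dtn T 1 (D.tildeFamily U (.h' i β))) T s =
      ds (dtn T β fun t s => D.variation U t s i) T s :=
    ds_congr (fun s hs => (iteratedDerivWithin_one_expTrigFun_right hT _ _).trans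
      (hU.coord_jet_variation hT h1 hs (β.2.le.trans hrn) i)) hs
  have e3 : dtn T 2 (D.tildeFamily U (.h'' i β)) T s = dtn T 1 (D.tildeFamily U (.h i β)) T s :=
    (iteratedDerivWithin_two_expTrigFun_right hT _ _).trans
      ((hasDerivAt_expFun _ _ T).deriv.trans (iteratedDerivWithin_one_expFun hT _ _ h1).symm)
  have e4 : ds (dtn T 1 (D.tildeFamily U (.h'' i β))) T s = ds (D.tildeFamily U (.h i β)) T s :=
    ds_congr (fun s _ => iteratedDerivWithin_one_expTrigFun_right hT _ _) hs
  rw [e1, e2, e3, e4]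
  change _ = _ - momentum T D.Q r (fun p => frozen D.L (U s).control p + D.dC p) β i
    (jet n T (D.controlledCurve (U s)) T) * _
  ring

lemma lagrangianPairing_add_auxPairing_right (hT : 0 < T) (hrn : r ≤ n) (hU : D.IsSmoothCurve U)
    (hs : s ∈ Icc (0 : ℝ) 1) :
    D.lagrangianPairing U T s + D.auxPairing U T s - D.muCorrection U T s =
      -ds (D.costAlong U) T s := by
  rw [hU.auxPairing_right hT hrn hs, hU.totalPairing_eq hT hrn ⟨hT.le, le_rfl⟩ hs]
  ring

/-! ## The Poincaré-Cartan form -/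

/-- Collecting the terms of the Poincaré–Cartan form by β = δ − ε − 1 yields the momenta. The index
ε = δ allowed in `momentum` never satisfies its constraint. -/
lemma sum_momentum_mul (f : Jet (Fin N) n → ℝ) (Q : Set (Fin N → ℝ)) (i : Fin N)
    (p : Jet (Fin N) n) (x : ℕ → ℝ) :
    ∑ δ ∈ Finset.Icc 1 r, ∑ ε ∈ Finset.range δ,
      (-1 : ℝ) ^ ε * ((totalDeriv T Q)^[ε] (partialQ T Q f δ i)) p * x (δ - (ε + 1)) =
      ∑ β ∈ Finset.range (r + 1), momentum T Q r f β i p * x β := by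
  simp only [momentum, Finset.sum_mul]
  rw [Finset.sum_comm]
  refine Finset.sum_congr rfl fun δ hδ => ?_
  rw [Finset.mem_Icc] at hδ
  rw [Finset.sum_comm, Finset.sum_range_succ, Finset.sum_eq_zero (s := Finset.range (r + 1)),
    add_zero]
  · refine Finset.sum_congr rfl fun ε hε => ?_
    rw [Finset.mem_range] at hε
    rw [Finset.sum_eq_single (δ - (ε + 1)), if_pos (by omega)]
    · intro β _ hβ
      rw [if_neg (by omega), zero_mul]
    · intro h
      exact absurd (Finset.mem_range.2 (by omega)) h
  · intro β _
    rw [if_neg (by omega), zero_mul]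

/-- The variation keeps time fixed, so the `dt` term vanishes and each contact form reduces to the
variation of its coordinate; moreover λ = 1 throughout. -/
lemma alphaPC_YHat (hT : 0 < T) (hrn : r ≤ n) (hn : 3 ≤ n) (hU : D.IsSmoothCurve U)
    (ht : t ∈ Icc 0 T) (hs : s ∈ Icc (0 : ℝ) 1) :
    D.alphaPC (U s).control (D.hatJet U t s) (D.YHat U t s) =
      D.totalPairing U t s + D.auxPairing U t s - ∫ τ in (0 : ℝ)..t, ds (D.LTildeAlong U) τ s := by
  have hn2 : 2 ≤ n := by omega
  have hY1 : (D.YHat U t s).1.1 = 0 := by rw [hU.YHat_eq hT hrn hn2 ht hs]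
  have hlam : dtn T 0 (D.hatFamily U .lam) t s = 1 := by rw [dtn_zero]; rfl
  have hmu : ds (D.hatFamily U .mu) t s = -∫ τ in (0 : ℝ)..t, ds (D.LTildeAlong U) τ s :=
    (hU.hasDerivWithinAt_mu_snd hT hrn hn2 ht hs).derivWithin (uniqueDiffOn_Icc zero_lt_one s hs)
  have hc : ∀ (ℓ : HatIdx N r) {δ : ℕ}, δ ≤ n → contactForm (D.hatJet U t s).1 ℓ δ
      (D.YHat U t s).1 = ds (dtn T δ (D.hatFamily U ℓ)) t s := fun ℓ δ hδ => by
    rw [contactForm, hY1, mul_zero, sub_zero, hU.coord_YHat hT hrn hn2 ht hs hδ]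
  have hq : ∀ i : Fin N, ∑ δ ∈ Finset.Icc 1 r, ∑ ε ∈ Finset.range δ, (-1 : ℝ) ^ ε
        * ((totalDeriv T D.Q)^[ε]
            (partialQ T D.Q (fun p => frozen D.L (U s).control p + D.dC p) δ i))
          (TildeIdx.base (HatIdx.toTilde (D.hatJet U t s).1))
        * contactForm (D.hatJet U t s).1 (.tilde (.q i)) (δ - (ε + 1)) (D.YHat U t s).1 =
      ∑ β ∈ Finset.range (r + 1),
        momentum T D.Q r (fun p => frozen D.L (U s).control p + D.dC p) β i
          (jet n T (D.controlledCurve (U s)) t)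
        * ds (dtn T β fun t s => D.variation U t s i) t s := by
    intro i
    rw [← sum_momentum_mul _ _ _ _ fun β => ds (dtn T β fun t s => D.variation U t s i) t s]
    refine Finset.sum_congr rfl fun δ hδ => Finset.sum_congr rfl fun ε _ => ?_
    rw [Finset.mem_Icc] at hδ
    rw [hU.base_hatJet hT hrn hn2 ht hs, hc _ (show δ - (ε + 1) ≤ n by omega)]
    rfl
  simp only [alphaPC, hq, hY1, hc _ (Nat.zero_le n), hc _ (show 1 ≤ n by omega),
    hU.coord_hatJet hT hrn hn2 ht hs (Nat.zero_le n), hlam,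
    hU.coord_hatJet hT hrn hn2 ht hs (show 1 ≤ n by omega),
    hU.coord_hatJet hT hrn hn2 ht hs hn2, hU.coord_hatJet hT hrn hn2 ht hs hn, mul_zero, one_mul,
    zero_add, dtn_zero, hmu, ← sub_eq_add_neg]
  congr 2
  refine Finset.sum_congr rfl fun i _ => Finset.sum_congr rfl fun β _ => ?_
  simp only [show ∀ ℓ, D.hatFamily U (.tilde ℓ) = D.tildeFamily U ℓ from fun _ => rfl]
  ring

/-! ## The main formulas -/

lemma terminalCost_sub (hT : 0 < T) (hr : 1 ≤ r) (hn : 2 * r + 1 ≤ n) (hU : D.IsSmoothCurve U) :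
    D.terminalCost (U 1) - D.terminalCost (U 0) =
      -∫ t in (0 : ℝ)..T, ∫ s in (0 : ℝ)..1,
        ((∑ a : Fin M, (D.Y U t s).2 a *
            D.partialP (jet n T (D.controlledCurve (U s)) t) a ((U s).control t))
          - D.mixedDerivMu' U t s) := by
  have hrn : r ≤ n := by omega
  have hn3 : 3 ≤ n := by omega
  have h1 : T ∈ Icc 0 T := ⟨hT.le, le_rfl⟩
  have hB := hU.smoothOnRect_lagrangianPairing hT
  have hH := hU.smoothOnRect_auxPairing hT hrn
  have hW := hU.smoothOnRect_muCorrection hT hrn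
  have hL := hU.smoothOnRect_lagrangianAlong hT
  have hA := hU.smoothOnRect_auxLagrangian hT hrn
  have hZ := (hB.add hH).sub hW
  -- In the integrand, −δL from the control term cancels the δL inside δL̃, leaving only the time
  -- derivatives of the three boundary terms.
  have hint : ∀ t ∈ Icc 0 T, ∀ s ∈ Icc (0 : ℝ) 1, (∑ a : Fin M, (D.Y U t s).2 a *
      D.partialP (jet n T (D.controlledCurve (U s)) t) a ((U s).control t))
        - D.mixedDerivMu' U t s =
      dt T (fun t s => D.lagrangianPairing U t s + D.auxPairing U t s
        - D.muCorrection U t s) t s := by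
    intro t ht s hs
    have e1 : dt T (fun t s => D.lagrangianPairing U t s + D.auxPairing U t s
        - D.muCorrection U t s) t s = _ :=
      (((hB.hasDerivWithinAt_fst hT ht hs).add (hH.hasDerivWithinAt_fst hT ht hs)).sub
        (hW.hasDerivWithinAt_fst hT ht hs)).derivWithin (uniqueDiffOn_Icc hT t ht)
    have e2 : ds (D.LTildeAlong U) t s =
        ds (D.lagrangianAlong U) t s + ds (D.auxLagrangian U) t s :=
      (ds_congr (g := fun t s => D.lagrangianAlong U t s + D.auxLagrangian U t s)
        (fun s hs => hU.LTildeAlong_eq hT hrn (by omega) ht hs) hs).trans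
        (((hL.hasDerivWithinAt_snd ht hs).add
          (hA.hasDerivWithinAt_snd ht hs)).derivWithin (uniqueDiffOn_Icc zero_lt_one s hs))
    rw [e1, hU.sum_control_variation hT ht hs, hU.mixedDerivMu'_eq hT hrn hn3 ht hs, e2,
      hU.dt_lagrangianPairing hT hr (by omega) ht hs, hU.dt_auxPairing hT hrn ht hs]
    ring
  have hint' : ∫ t in (0 : ℝ)..T, ∫ s in (0 : ℝ)..1,
      ((∑ a : Fin M, (D.Y U t s).2 a *
          D.partialP (jet n T (D.controlledCurve (U s)) t) a ((U s).control t))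
        - D.mixedDerivMu' U t s) =
      ∫ t in (0 : ℝ)..T, ∫ s in (0 : ℝ)..1, dt T (fun t s => D.lagrangianPairing U t s
        + D.auxPairing U t s - D.muCorrection U t s) t s := by
    refine intervalIntegral.integral_congr fun t ht =>
      intervalIntegral.integral_congr fun s hs => ?_
    rw [uIcc_of_le hT.le] at ht
    rw [uIcc_of_le zero_le_one] at hs
    exact hint t ht s hs
  -- With the time integral innermost, only the end values of B + H − W remain: −δC at `T` and zero
  -- at `0`.
  have hends : ∫ s in (0 : ℝ)..1, ∫ t in (0 : ℝ)..T, dt T (fun t s => D.lagrangianPairing U t s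
        + D.auxPairing U t s - D.muCorrection U t s) t s =
      ∫ s in (0 : ℝ)..1, -ds (D.costAlong U) T s := by
    refine intervalIntegral.integral_congr fun s hs => ?_
    rw [uIcc_of_le zero_le_one] at hs
    rw [hZ.integral_dt hT hs, hU.lagrangianPairing_add_auxPairing_right hT hrn hs,
      hU.auxPairing_zero hT hrn hs, muCorrection_zero hT hs]
    ring
  rw [hint', integral_swap_rect h1 ⟨zero_le_one, le_rfl⟩ (hZ.dt hT).continuousOn, hends,
    intervalIntegral.integral_neg, (hU.smoothOnRect_costAlong hT).integral_ds hT h1, neg_neg]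
  rfl

lemma alphaPC_right (hT : 0 < T) (hrn : r ≤ n) (hn : 3 ≤ n) (hU : D.IsSmoothCurve U)
    (hs : s ∈ Icc (0 : ℝ) 1) :
    D.alphaPC (U s).control (D.hatJet U T s) (D.YHat U T s) =
      D.alphaPC (U s).control (D.hatJet U 0 s) (D.YHat U 0 s)
        + ∫ t in (0 : ℝ)..T, D.mixedDerivMu' U t s := by
  have h0 : (0 : ℝ) ∈ Icc 0 T := ⟨le_rfl, hT.le⟩
  have h1 : T ∈ Icc 0 T := ⟨hT.le, le_rfl⟩
  rw [hU.alphaPC_YHat hT hrn hn h1 hs, hU.alphaPC_YHat hT hrn hn h0 hs,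
    hU.integral_mixedDerivMu' hT hrn hn hs, hU.auxPairing_right hT hrn hs,
    hU.auxPairing_zero hT hrn hs, hU.totalPairing_eq hT hrn h0 hs,
    hU.ds_costAlong_zero hT hs, muCorrection_zero hT hs,
    intervalIntegral.integral_same]
  ring

end IsSmoothCurve

end DefiningTriple

end GeneralisedMayer

end

theorem corollary6p2 {N M n r : ℕ} {T : ℝ} (hT : 0 < T) (hr : 1 ≤ r) (hn : 2 * r + 1 ≤ n)
    (D : GeneralisedMayer.DefiningTriple N M n r T)
    (U : ℝ → GeneralisedMayer.ControlPair N M r) (hU : D.IsSmoothCurve U) :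
    (D.terminalCost (U 1) - D.terminalCost (U 0) =
      -∫ t in (0 : ℝ)..T, ∫ s in (0 : ℝ)..1,
        ((∑ a : Fin M, (D.Y U t s).2 a *
            D.partialP (GeneralisedMayer.jet n T (D.controlledCurve (U s)) t) a ((U s).control t))
          - D.mixedDerivMu' U t s)) ∧
    (∀ s₀ ∈ Set.Icc (0 : ℝ) 1,
      D.alphaPC (U s₀).control (D.hatJet U T s₀) (D.YHat U T s₀) =
        D.alphaPC (U s₀).control (D.hatJet U 0 s₀) (D.YHat U 0 s₀)
          + ∫ t in (0 : ℝ)..T, D.mixedDerivMu' U t s₀) :=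
  ⟨hU.terminalCost_sub hT hr hn, fun _ hs => hU.alphaPC_right hT (by omega) (by omega) hs⟩
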